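/- **Definitions.** Let $P$ and $\Sigma$ be finite sets (of processes and labels). A *message sequence chart* (MSC) over $P$ and $\Sigma$ is a tuple $M=(E,\to,\lhd,\mathit{loc},\lambda)$ with a nonempty finite set $E$ of events, maps $\mathit{loc}:E\to P$ and $\lambda:E\to\Sigma$, and relations $\to,\lhd\subseteq E\times E$ such that, with $E_p=\mathit{loc}^{-1}(p)$: (i) $e\to f$ implies $\mathit{loc}(e)=\mathit{loc}(f)$, and for every $p\in P$ the relation ${\to}\cap(E_p\times E_p)$ is the direct successor relation of some total order on $E_p$; (ii) every event belongs to at most one pair of $\lhd$; (iii) for all $(e,f),(e',f')\in{\lhd}$ with $e,e'\in E_p$ and $f,f'\in E_q$ we have $p\ne q$ and ($e\to^* e'$ iff $f\to^* f'$) (FIFO); (iv) ${\le}:=({\to}\cup{\lhd})^*$ is a partial order. Its strict part is ${<}=({\to}\cup{\lhd})^+$. For $e\in E$ and $p\in P$, let $\mathrm{latest}_p(e)$ be the $\le$-maximum of $\{f\in E_p\mid f<e\}$ if this set is nonempty, and $\bot$ otherwise; put $\lambda(\bot)=\bot\notin\Sigma$. A *communicating finite-state machine* (CFM) over $P$ and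 $\Sigma$ consists of a finite message set $\mathit{Msg}$, for each $p\in P$ a finite set $S_p$ of local states with an initial state $\iota_p$ and a transition relation $\Delta_p$, and a set $\mathit{Acc}\subseteq\prod_{p}S_p$. A transition in $\Delta_p$ is a triple $(s,\gamma,s')$ with $s,s'\in S_p$, where $\gamma$ carries a label $a\in\Sigma$ and is either local, or sends some $m\in\mathit{Msg}$ to some $q\neq p$, or receives some $m\in\mathit{Msg}$ from some $q\ne p$. The machine may be non-deterministic. A *run* on an MSC $M$ assigns to each $e\in E_p$ a transition $\rho(e)\in\Delta_p$ with label $\lambda(e)$ such that: the source of $\rho(e)$ is $\iota_p$ if $e$ is the first event of $E_p$; the target of $\rho(e)$ is the source of $\rho(f)$ whenever $e\to f$; $\rho(e)$ is local if $e$ belongs to no pair of $\lhd$; and if $e\lhd f$ with $e\in E_p$, $f\in E_q$, then, for some $m\in\mathit{Msg}$, $\rho(e)$ sends $m$ to $q$ and $\rho(f)$ receives $m$ from $p$. The run is *accepting* if $(s_p)_{p\in P}\in\mathit{Acc}$, where $s_p$ is the target of $\rho(e)$ for the last event $e$ of $E_p$, and $s_p=\iota_p$ if $E_p=\emptyset$.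 The *language* $L(\mathcal A)$ is the set of MSCs on which $\mathcal A$ has an accepting run. The *number of states* of $\mathcal A$ is $\sum_{p\in P}|S_p|$. Let $\Xi$ be the set of functions $P\to\Sigma\cup\{\bot\}$. An *extended MSC* is an MSC over $P$ and $\Sigma\times\Xi$, regarded as a pair $(M,\xi)$ of an MSC $M=(E,\to,\lhd,\mathit{loc},\lambda)$ over $P$ and $\Sigma$ and a map $\xi:E\to\Xi$. **Theorem.** There is an absolute constant $c>0$ such that for all finite sets $P$ and $\Sigma$ there is a CFM $\mathcal A_{\mathsf{gossip}}$ over $P$ and $\Sigma\times\Xi$ whose language is exactly the set of extended MSCs $(M,\xi)$ such that, for all events $e\in E$ and all $p\in P$, $$\xi(e)(p)=\lambda(\mathrm{latest}_p(e)),$$ and whose number of states is at most $$\max(|\Sigma|,2)^{\,2^{\,c\,|P|\log(\max(|P|,2))}} .$$ In particular, for $|\Sigma|\ge 2$ and $|P|\ge2$ it has $|\Sigma|^{2^{\mathcal O(|P|\log|P|)}}$ states. -/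

import Mathlib

universe u v w

/-- A message sequence chart over the set of processes `P` and the set of labels `A`. -/
structure MSC (P : Type u) (A : Type v) where
  /-- the events -/
  Event : Type w
  [finite_event : Finite Event]
  [nonempty_event : Nonempty Event]
  /-- the process relation: `next e f` if `f` directly follows `e` on their process -/
  next : Event → Event → Prop
  /-- the message relation: `msg e f` if `e` sends the message that `f` receives -/
  msg : Event → Event → Prop
  /-- the process of an event -/
  loc : Event → P
  /-- the label of an event -/
  label : Event → A
  loc_eq_of_next : ∀ e f, next e f → loc e = loc f
  /-- On each process, `next` is the direct successor relation of some total order. -/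
  next_iff_covBy : ∀ p, ∃ _ : LinearOrder {e : Event // loc e = p},
    ∀ e f : {e : Event // loc e = p}, next e f ↔ e ⋖ f
  /-- Every event belongs to at most one pair of the message relation. -/
  msg_unique : ∀ e f e' f', msg e f → msg e' f' →
    (e = e' ∨ e = f' ∨ f = e' ∨ f = f') → e = e' ∧ f = f'
  /-- A message goes from one process to another one. -/
  msg_loc_ne : ∀ e f, msg e f → loc e ≠ loc f
  /-- Each channel is first-in first-out. -/
  fifo : ∀ e f e' f', msg e f → msg e' f' → loc e = loc e' → loc f = loc f' →
    (Relation.ReflTransGen next e e' ↔ Relation.ReflTransGen next f f')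
  /-- The reflexive transitive closure of `next ∪ msg` is a partial order. -/
  antisymm : ∀ e f, Relation.ReflTransGen (fun x y => next x y ∨ msg x y) e f →
    Relation.ReflTransGen (fun x y => next x y ∨ msg x y) f e → e = f

namespace MSC

variable {P : Type u} {A : Type v} (M : MSC.{u, v, w} P A)

instance : Finite M.Event := M.finite_event

instance : Nonempty M.Event := M.nonempty_event

/-- One step of the causal order. -/
def step (e f : M.Event) : Prop := M.next e f ∨ M.msg e f

theorem step_ne {e f : M.Event} (h : M.step e f) : e ≠ f := by
  rintro rfl
  rcases h with h | h
  · obtain ⟨_, hc⟩ := M.next_iff_covBy (M.loc e)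
    exact ((hc ⟨e, rfl⟩ ⟨e, rfl⟩).1 h).lt.ne rfl
  · exact M.msg_loc_ne _ _ h rfl

theorem reflTransGen_total {e f : M.Event} (h : M.loc e = M.loc f) :
    Relation.ReflTransGen M.step e f ∨ Relation.ReflTransGen M.step f e := by
  classical
  obtain ⟨_, hc⟩ := M.next_iff_covBy (M.loc f)
  have := Fintype.ofFinite {x : M.Event // M.loc x = M.loc f}
  let _ := Fintype.toLocallyFiniteOrder (α := {x : M.Event // M.loc x = M.loc f})
  have key : ∀ a b : {x : M.Event // M.loc x = M.loc f}, a ≤ b →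
      Relation.ReflTransGen M.step a b := by
    intro a b hab
    have hab' := le_iff_reflTransGen_covBy.1 hab
    induction hab' with
    | refl => exact Relation.ReflTransGen.refl
    | tail h1 h2 ih =>
      exact (ih (le_iff_reflTransGen_covBy.2 h1)).tail (Or.inl ((hc _ _).2 h2))
  exact (le_total (⟨e, h⟩ : {x : M.Event // M.loc x = M.loc f}) ⟨f, rfl⟩).imp
    (key _ _) (key _ _)

/-- The causal order: `e ≤ f` iff `(e, f) ∈ (next ∪ msg)^*` and `e < f` iff
`(e, f) ∈ (next ∪ msg)^+`. -/
instance : PartialOrder M.Event where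
  le := Relation.ReflTransGen M.step
  lt := Relation.TransGen M.step
  le_refl _ := Relation.ReflTransGen.refl
  le_trans _ _ _ := Relation.ReflTransGen.trans
  le_antisymm e f := M.antisymm e f
  lt_iff_le_not_ge e f := by
    constructor
    · intro h
      refine ⟨h.to_reflTransGen, fun h' => ?_⟩
      obtain ⟨g, hg, hgf⟩ := Relation.TransGen.head'_iff.1 h
      exact M.step_ne hg
        (M.antisymm e g (Relation.ReflTransGen.single hg) (hgf.trans h'))
    · rintro ⟨h, h'⟩
      rcases Relation.reflTransGen_iff_eq_or_transGen.1 h with rfl | h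
      · exact absurd Relation.ReflTransGen.refl h'
      · exact h

/-- Events of the same process are causally comparable. -/
theorem le_total_of_loc_eq {e f : M.Event} (h : M.loc e = M.loc f) : e ≤ f ∨ f ≤ e :=
  M.reflTransGen_total h

/-- The events of process `p` in the strict causal past of `f`. -/
def past (p : P) (f : M.Event) : Set M.Event := {e | M.loc e = p ∧ e < f}

theorem exists_isGreatest_past {p : P} {f : M.Event} (h : (M.past p f).Nonempty) :
    ∃ e, IsGreatest (M.past p f) e := by
  obtain ⟨m, hm⟩ := (Set.toFinite (M.past p f)).exists_maximal h
  refine ⟨m, hm.prop, fun e he => ?_⟩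
  rcases M.le_total_of_loc_eq (he.1.trans hm.prop.1.symm) with h' | h'
  · exact h'
  · exact hm.le_of_ge he h'

open Classical in
/-- The most recent event of process `p` in the strict causal past of `f`, or `none` (written
`⊥` in mathematics) if there is no such event. -/
noncomputable def latest (p : P) (f : M.Event) : Option M.Event :=
  if h : (M.past p f).Nonempty then some (M.exists_isGreatest_past h).choose else none

theorem latest_eq_some_iff {p : P} {e f : M.Event} :
    M.latest p f = some e ↔ IsGreatest (M.past p f) e := by
  unfold latest
  split_ifs with h
  · have hs := (M.exists_isGreatest_past h).choose_spec
    rw [Option.some.injEq]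
    exact ⟨fun h' => h' ▸ hs, fun h' => hs.unique h'⟩
  · simp only [false_iff]
    exact fun h' => h ⟨e, h'.1⟩

theorem latest_eq_none_iff {p : P} {f : M.Event} : M.latest p f = none ↔ M.past p f = ∅ := by
  unfold latest
  split_ifs with h
  · simpa using h.ne_empty
  · simpa using Set.not_nonempty_iff_eq_empty.1 h

end MSC

/-- What a transition does: `loc a` is a local action labelled `a`; `send a m q` is labelled `a`
and sends the message `m` to process `q`; `recv a m q` is labelled `a` and receives the message
`m` from process `q`. -/
inductive CFMAction (P : Type u) (A : Type v) (Msg : Type w) : Type (max u v w)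
  | loc (a : A)
  | send (a : A) (m : Msg) (q : P)
  | recv (a : A) (m : Msg) (q : P)

/-- The label of an action. -/
def CFMAction.label {P : Type u} {A : Type v} {Msg : Type w} : CFMAction P A Msg → A
  | .loc a => a
  | .send a _ _ => a
  | .recv a _ _ => a

/-- A communicating finite-state machine over the processes `P` and the labels `A`. -/
structure CFM (P : Type u) (A : Type v) where
  /-- the local states of each process -/
  State : P → Type (max u v)
  [finite_state : ∀ p, Finite (State p)]
  /-- the messages -/
  Msg : Type (max u v)
  [finite_msg : Finite Msg]
  /-- the initial state of each process -/
  init : ∀ p, State p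
  /-- the transitions (source, action, target) of each process -/
  trans : ∀ p, Set (State p × CFMAction P A Msg × State p)
  send_ne : ∀ p s a m q s', (s, CFMAction.send a m q, s') ∈ trans p → q ≠ p
  recv_ne : ∀ p s a m q s', (s, CFMAction.recv a m q, s') ∈ trans p → q ≠ p
  /-- the accepting tuples of local states -/
  acc : Set (∀ p, State p)

namespace CFM

variable {P : Type u} {A : Type v} (C : CFM P A)

/-- The number of (local) states of the machine, summed over all processes. -/
noncomputable def numStates [Fintype P] : ℕ := ∑ p, Nat.card (C.State p)

/-- A run of `C` on `M`: an assignment `ρ` of transitions to events, where `ρ p e` is the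
transition executed at the event `e` of process `p`. -/
structure IsRun (M : MSC.{u, v, w} P A)
    (ρ : ∀ p, {e : M.Event // M.loc e = p} →
      C.State p × CFMAction P A C.Msg × C.State p) : Prop where
  mem_trans : ∀ p e, ρ p e ∈ C.trans p
  label_eq : ∀ p e, (ρ p e).2.1.label = M.label e
  source_init : ∀ p (e : {e : M.Event // M.loc e = p}),
    (¬ ∃ d : M.Event, M.next d e) → (ρ p e).1 = C.init p
  target_eq_source : ∀ p (e f : {e : M.Event // M.loc e = p}),
    M.next e f → (ρ p e).2.2 = (ρ p f).1
  local_event : ∀ p (e : {e : M.Event // M.loc e = p}),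
    (¬ ∃ f : M.Event, M.msg e f ∨ M.msg f e) → ∃ a, (ρ p e).2.1 = CFMAction.loc a
  message : ∀ p q (e : {e : M.Event // M.loc e = p}) (f : {e : M.Event // M.loc e = q}),
    M.msg e f → ∃ a b m, (ρ p e).2.1 = CFMAction.send a m q ∧
      (ρ q f).2.1 = CFMAction.recv b m p

/-- The assignment `ρ` ends in an accepting tuple of local states: the last state of a process is
the target of the transition at its last event, or the initial state if it has no event. -/
def IsAccepting (M : MSC.{u, v, w} P A)
    (ρ : ∀ p, {e : M.Event // M.loc e = p} →
      C.State p × CFMAction P A C.Msg × C.State p) : Prop :=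
  ∃ s ∈ C.acc, ∀ p,
    (∀ e : {e : M.Event // M.loc e = p},
      (¬ ∃ f : M.Event, M.next e f) → s p = (ρ p e).2.2) ∧
    ((¬ ∃ e : M.Event, M.loc e = p) → s p = C.init p)

/-- The language of `C`: the set of message sequence charts with an accepting run. -/
def language : Set (MSC.{u, v, w} P A) :=
  {M | ∃ ρ, C.IsRun M ρ ∧ C.IsAccepting M ρ}

end CFM

/-- An extended message sequence chart over `P` and `L`: each event `e` has a label
`λ(e) = (label e).1` in `L` and an output `ξ(e) = (label e).2`, a function from `P` to
`L ∪ {⊥}`. -/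
abbrev ExtMSC (P : Type u) (L : Type v) := MSC.{u, max u v, w} P (L × (P → Option L))

/-- The extended message sequence charts such that `ξ(e)(p) = λ(latest_p(e))` for all events `e`
and all processes `p`, where `λ(⊥) = ⊥`. -/
def gossipLanguage (P : Type u) (L : Type v) : Set (ExtMSC.{u, v, w} P L) :=
  {M | ∀ e : M.Event,
    (M.label e).2 = fun p => (M.latest p e).map (fun e' => (M.label e').1)}

/-! The machine guesses an annotation of the events and checks it locally. For `p ≠ loc e`, the
latest event of `p` is the greatest of the events `back v e`, where `v` ends in `p` and each letter
leads from an event to the last message received from that process. Loops in such a walk can be cut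
out, so words of length at most `|P|` suffice (`exists_back`). The labels of the events `back v e`
are determined by forwarding them along messages.

It remains to decide which candidate is greatest, although positions on a process are unbounded. For
a guessed set `C` of events, compare the number of elements of `C` strictly before `back v e` with
the number up to and including `back v' e`. If the first is smaller, then `back v e ≤ back v' e`,
whatever `C` is (`le_of_level_lt`), so a bad guess never causes a wrong output. Conversely, for each
process and each pair of words with a common last letter, a greedily chosen `C` makes the inequality
strict whenever `back v e ≤ back v' e`, keeps the difference of the counts in `{0, 1, 2}`, and lets
each count rise by at most one per event (`exists_separating_set`, `exists_separates`).

Only the increments of the counts are needed, cut off at 2, and by FIFO they are locally checkable: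
when a message from `r` is received, the count along `r :: v` rises by what the count along `v`
gained at the sender since its previous message on the same channel (`jump_lastSend`). An annotation
is thus a tuple of bounded entries indexed by `|P|^O(|P|)` positions, which gives the bound on the
states. -/

theorem reflTransGen_of_le {α : Type*} {β : Type*} [LinearOrder α] [Finite α]
    {r : β → β → Prop} {g : α → β} (h : ∀ a b, a ⋖ b → r (g a) (g b)) {a b : α} (hab : a ≤ b) :
    Relation.ReflTransGen r (g a) (g b) := by
  classical
  have := Fintype.ofFinite α
  let _ := Fintype.toLocallyFiniteOrder (α := α)
  have hab' := le_iff_reflTransGen_covBy.1 hab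
  induction hab' with
  | refl => exact Relation.ReflTransGen.refl
  | tail h1 h2 ih => exact (ih (le_iff_reflTransGen_covBy.2 h1)).tail (h _ _ h2)

/-! ### Predecessors, senders and targets of events -/

namespace MSC

variable {P : Type u} {A : Type v} (M : MSC.{u, v, w} P A)

theorem next_lt {d e : M.Event} (h : M.next d e) : d < e :=
  Relation.TransGen.single (Or.inl h)

theorem msg_lt {d e : M.Event} (h : M.msg d e) : d < e :=
  Relation.TransGen.single (Or.inr h)

/-- This turns the FIFO axiom, stated with `next`, into a statement about the causal order. -/
theorem reflTransGen_next {e f : M.Event} :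
    Relation.ReflTransGen M.next e f ↔ M.loc e = M.loc f ∧ e ≤ f := by
  have hmono : ∀ e f : M.Event, Relation.ReflTransGen M.next e f → e ≤ f := by
    intro e f h
    induction h with
    | refl => exact le_rfl
    | tail _ h2 ih => exact ih.trans (M.next_lt h2).le
  constructor
  · intro h
    refine ⟨?_, hmono e f h⟩
    induction h with
    | refl => rfl
    | tail _ h2 ih => exact ih.trans (M.loc_eq_of_next _ _ h2)
  · rintro ⟨hl, hle⟩
    obtain ⟨inst, hc⟩ := M.next_iff_covBy (M.loc f)
    have key := fun a b => @reflTransGen_of_le _ _ inst _ M.next Subtype.val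
      (fun a b h => (hc a b).2 h) a b
    rcases @le_total _ inst ⟨e, hl⟩ ⟨f, rfl⟩ with h | h
    · exact key _ _ h
    · rw [le_antisymm hle (hmono _ _ (key _ _ h))]

theorem next_iff_latest {d e : M.Event} :
    M.next d e ↔ M.latest (M.loc e) e = some d := by
  rw [latest_eq_some_iff]
  constructor
  · intro h
    refine ⟨⟨M.loc_eq_of_next _ _ h, M.next_lt h⟩, ?_⟩
    rintro x ⟨hx, hxe⟩
    rcases Relation.ReflTransGen.cases_tail (M.reflTransGen_next.2 ⟨hx, hxe.le⟩) with rfl | ⟨y, hxy, hye⟩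
    · exact absurd hxe (lt_irrefl _)
    · have : y = d := by
        obtain ⟨_, hc⟩ := M.next_iff_covBy (M.loc e)
        have h1 := (hc ⟨y, M.loc_eq_of_next _ _ hye⟩ ⟨e, rfl⟩).1 hye
        have h2 := (hc ⟨d, M.loc_eq_of_next _ _ h⟩ ⟨e, rfl⟩).1 h
        exact congrArg Subtype.val (h1.unique_left h2)
      exact this ▸ (M.reflTransGen_next.1 hxy).2
  · rintro ⟨⟨hd, hde⟩, hmax⟩
    rcases Relation.ReflTransGen.cases_tail (M.reflTransGen_next.2 ⟨hd, hde.le⟩) with rfl | ⟨y, hdy, hye⟩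
    · exact absurd hde (lt_irrefl _)
    · have h1 : y ≤ d := hmax ⟨M.loc_eq_of_next _ _ hye, M.next_lt hye⟩
      rwa [le_antisymm h1 (M.reflTransGen_next.1 hdy).2] at hye

/-- The predecessor of an event on its process. -/
noncomputable def pred (e : M.Event) : Option M.Event := M.latest (M.loc e) e

theorem pred_eq_some {d e : M.Event} : M.pred e = some d ↔ M.next d e :=
  M.next_iff_latest.symm

theorem pred_eq_none {e : M.Event} : M.pred e = none ↔ ∀ d, ¬ M.next d e := by
  simp only [← pred_eq_some, Option.eq_none_iff_forall_ne_some]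

theorem loc_pred {d e : M.Event} (h : M.pred e = some d) : M.loc d = M.loc e :=
  M.loc_eq_of_next _ _ (M.pred_eq_some.1 h)

theorem pred_lt {d e : M.Event} (h : M.pred e = some d) : d < e :=
  M.next_lt (M.pred_eq_some.1 h)

theorem le_pred {d e x : M.Event} (h : M.pred e = some d) (hx : M.loc x = M.loc e)
    (hxe : x < e) : x ≤ d :=
  (M.latest_eq_some_iff.1 h).2 ⟨hx, hxe⟩

theorem not_lt_of_pred_eq_none {e x : M.Event} (h : M.pred e = none)
    (hx : M.loc x = M.loc e) : ¬ x < e := by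
  intro hxe
  have : x ∈ M.past (M.loc e) e := ⟨hx, hxe⟩
  rw [M.latest_eq_none_iff.1 h] at this
  exact this

theorem lt_or_eq_or_gt {e f : M.Event} (h : M.loc e = M.loc f) : e < f ∨ e = f ∨ f < e := by
  rcases M.le_total_of_loc_eq h with h' | h'
  · rcases h'.lt_or_eq with h' | h' <;> simp [h']
  · rcases h'.lt_or_eq with h' | h' <;> simp [h']

/-- Induction along the causal order. -/
theorem event_induction {motive : M.Event → Prop}
    (h : ∀ e, (∀ d, d < e → motive d) → motive e) (e : M.Event) : motive e :=
  (Finite.to_wellFoundedLT (α := M.Event)).induction e h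

open Classical in
/-- The event of process `r` whose message is received at `e`, if there is one. -/
noncomputable def senderOn (r : P) (e : M.Event) : Option M.Event :=
  if h : ∃ s, M.msg s e ∧ M.loc s = r then some h.choose else none

theorem senderOn_eq_some {r : P} {s e : M.Event} :
    M.senderOn r e = some s ↔ M.msg s e ∧ M.loc s = r := by
  unfold senderOn
  split_ifs with h
  · rw [Option.some.injEq]
    refine ⟨fun h' => h' ▸ h.choose_spec, fun h' => ?_⟩
    exact (M.msg_unique _ _ _ _ h.choose_spec.1 h'.1 (by simp)).1
  · simp only [false_iff]
    exact fun h' => h ⟨s, h'⟩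

theorem senderOn_eq_none {r : P} {e : M.Event} :
    M.senderOn r e = none ↔ ∀ s, M.msg s e → M.loc s ≠ r := by
  simp only [Option.eq_none_iff_forall_ne_some, ne_eq, senderOn_eq_some, not_and]

open Classical in
/-- The process to which a message is sent at `e`, if there is one. -/
noncomputable def target (e : M.Event) : Option P :=
  if h : ∃ f, M.msg e f then some (M.loc h.choose) else none

theorem target_eq_some {t : P} {e : M.Event} :
    M.target e = some t ↔ ∃ f, M.msg e f ∧ M.loc f = t := by
  unfold target
  split_ifs with h
  · rw [Option.some.injEq]
    refine ⟨fun h' => ⟨_, h.choose_spec, h'⟩, ?_⟩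
    rintro ⟨f, hf, rfl⟩
    rw [(M.msg_unique _ _ _ _ h.choose_spec hf (by simp)).2]
  · simp only [false_iff]
    exact fun ⟨f, h', _⟩ => h ⟨f, h'⟩

theorem target_eq_none {e : M.Event} : M.target e = none ↔ ∀ f, ¬ M.msg e f := by
  simp only [Option.eq_none_iff_forall_ne_some, ne_eq, target_eq_some]
  exact ⟨fun h f hf => h _ ⟨f, hf, rfl⟩, fun h t ⟨f, hf, _⟩ => h f hf⟩

end MSC

/-! ### Machines that guess and check an annotation -/

section LocalCheck

variable {P : Type u} {A : Type v} {X : Type (max u v)}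

/-- `χ` is an annotation of the events of `M` that satisfies `Chk` at each event: a condition on
the process, the label, the annotation of the predecessor, the annotation of the sender on each
process, the target of a message, and the annotation of the event. -/
def MSC.IsLocallyValid (Chk : P → A → Option X → (P → Option X) → Option P → X → Prop)
    (M : MSC.{u, v, w} P A) (χ : M.Event → X) : Prop :=
  ∀ e, Chk (M.loc e) (M.label e) ((M.pred e).map χ) (fun r => (M.senderOn r e).map χ)
    (M.target e) (χ e)

open Classical in
/-- The machine that guesses an annotation and checks it locally. -/
def CFM.ofCheck [Finite X] (Chk : P → A → Option X → (P → Option X) → Option P → X → Prop) :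
    CFM.{u, v} P A where
  State _ := Option X
  Msg := X
  init _ := none
  trans p := {t | ∃ x, t.2.2 = some x ∧ match t.2.1 with
    | .loc a => Chk p a t.1 (fun _ => none) none x
    | .send a m q => q ≠ p ∧ m = x ∧ Chk p a t.1 (fun _ => none) (some q) x
    | .recv a m q => q ≠ p ∧ Chk p a t.1 (fun r => if r = q then some m else none) none x}
  send_ne := by
    rintro p s a m q s' ⟨x, _, h⟩
    exact h.1
  recv_ne := by
    rintro p s a m q s' ⟨x, _, h⟩
    exact h.1
  acc := Set.univ

theorem CFM.numStates_ofCheck [Fintype P] [Finite X]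
    (Chk : P → A → Option X → (P → Option X) → Option P → X → Prop) :
    (CFM.ofCheck Chk).numStates = Fintype.card P * (Nat.card X + 1) := by
  simp [CFM.numStates, CFM.ofCheck, Finite.card_option]

/-- A local state holds the annotation of the last event and a message carries the annotation of its
sender, so a transition sees exactly the data that the local condition speaks about. -/
theorem CFM.mem_language_ofCheck [Finite X]
    (Chk : P → A → Option X → (P → Option X) → Option P → X → Prop) (M : MSC.{u, v, w} P A) :
    M ∈ (CFM.ofCheck Chk).language ↔ ∃ χ, M.IsLocallyValid Chk χ := by
  classical
  constructor
  · rintro ⟨ρ, hρ, -⟩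
    have hx : ∀ e : M.Event, ∃ x : X, (ρ (M.loc e) ⟨e, rfl⟩).2.2 = some x := fun e => by
      obtain ⟨x, hx, -⟩ := hρ.mem_trans (M.loc e) ⟨e, rfl⟩
      exact ⟨x, hx⟩
    choose χ hχ using hx
    have hχ' : ∀ p (e : {e : M.Event // M.loc e = p}), (ρ p e).2.2 = some (χ e) := by
      rintro p ⟨e, rfl⟩
      exact hχ e
    have hmsg : ∀ s f, M.msg s f → ∃ a b,
        (ρ (M.loc s) ⟨s, rfl⟩).2.1 = CFMAction.send a (χ s) (M.loc f) ∧
        (ρ (M.loc f) ⟨f, rfl⟩).2.1 = CFMAction.recv b (χ s) (M.loc s) := by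
      intro s f h
      obtain ⟨a, b, m, h1, h2⟩ := hρ.message _ _ ⟨s, rfl⟩ ⟨f, rfl⟩ h
      obtain ⟨x, hx, h3⟩ := hρ.mem_trans (M.loc s) ⟨s, rfl⟩
      rw [h1] at h3
      -- The send transition forces the message to be the sender's own annotation.
      have h4 := h3.2.1
      rw [hχ s] at hx
      obtain rfl := Option.some.inj hx
      subst h4
      exact ⟨a, b, h1, h2⟩
    refine ⟨χ, fun e => ?_⟩
    have hsrc : (ρ (M.loc e) ⟨e, rfl⟩).1 = (M.pred e).map χ := by
      cases hp : M.pred e with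
      | none =>
        exact hρ.source_init (M.loc e) ⟨e, rfl⟩ (not_exists.2 (M.pred_eq_none.1 hp))
      | some d =>
        have hd := hρ.target_eq_source (M.loc e) ⟨d, M.loc_pred hp⟩ ⟨e, rfl⟩ (M.pred_eq_some.1 hp)
        rw [← hd, hχ']
        rfl
    obtain ⟨x, hx, hc⟩ := hρ.mem_trans (M.loc e) ⟨e, rfl⟩
    rw [hχ e] at hx
    obtain rfl := Option.some.inj hx
    have hl := hρ.label_eq (M.loc e) ⟨e, rfl⟩
    rw [← hsrc]
    by_cases hs : ∃ f, M.msg e f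
    · obtain ⟨f, hf⟩ := hs
      obtain ⟨a, b, h1, -⟩ := hmsg e f hf
      have h2 : (fun r => (M.senderOn r e).map χ) = fun _ => none := by
        funext r
        rw [M.senderOn_eq_none.2, Option.map_none]
        intro s hs
        have := M.msg_unique _ _ _ _ hs hf (by simp)
        exact absurd (this.1 ▸ hs) fun h => M.msg_loc_ne _ _ h rfl
      rw [h2, M.target_eq_some.2 ⟨f, hf, rfl⟩]
      rw [h1] at hc hl
      rw [← hl]
      exact hc.2.2
    · by_cases hr : ∃ s, M.msg s e
      · obtain ⟨s, hs'⟩ := hr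
        obtain ⟨a, b, -, h1⟩ := hmsg s e hs'
        have h2 : (fun r => (M.senderOn r e).map χ) =
            fun r => if r = M.loc s then some (χ s) else none := by
          funext r
          split_ifs with h
          · rw [M.senderOn_eq_some.2 ⟨hs', h.symm⟩, Option.map_some]
          · rw [M.senderOn_eq_none.2, Option.map_none]
            intro s' h' h''
            rw [(M.msg_unique _ _ _ _ hs' h' (by simp)).1] at h
            exact h h''.symm
        rw [h2, M.target_eq_none.2 (not_exists.1 hs)]
        rw [h1] at hc hl
        rw [← hl]
        exact hc.2
      · obtain ⟨a, h1⟩ := hρ.local_event (M.loc e) ⟨e, rfl⟩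
          (by rintro ⟨f, h | h⟩; exacts [hs ⟨f, h⟩, hr ⟨f, h⟩])
        have h2 : (fun r => (M.senderOn r e).map χ) = fun _ => none := by
          funext r
          rw [M.senderOn_eq_none.2, Option.map_none]
          exact fun s h => absurd ⟨s, h⟩ hr
        rw [h2, M.target_eq_none.2 (not_exists.1 hs)]
        rw [h1] at hc hl
        rw [← hl]
        exact hc
  · rintro ⟨χ, hχ⟩
    let act : M.Event → CFMAction P A X := fun e =>
      if h : ∃ f, M.msg e f then .send (M.label e) (χ e) (M.loc h.choose)
      else if h : ∃ s, M.msg s e then .recv (M.label e) (χ h.choose) (M.loc h.choose)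
      else .loc (M.label e)
    have act_send : ∀ e f, M.msg e f → act e = .send (M.label e) (χ e) (M.loc f) := by
      intro e f hf
      have h : ∃ f, M.msg e f := ⟨f, hf⟩
      simp only [act, dif_pos h]
      rw [(M.msg_unique _ _ _ _ h.choose_spec hf (by simp)).2]
    have act_recv : ∀ s e, M.msg s e → act e = .recv (M.label e) (χ s) (M.loc s) := by
      intro s e hs
      have h : ∃ s, M.msg s e := ⟨s, hs⟩
      have h' : ¬ ∃ f, M.msg e f := by
        rintro ⟨f, hf⟩
        have := M.msg_unique _ _ _ _ hs hf (by simp)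
        exact absurd (this.1 ▸ hs) fun h => M.msg_loc_ne _ _ h rfl
      simp only [act, dif_pos h, dif_neg h']
      rw [(M.msg_unique _ _ _ _ h.choose_spec hs (by simp)).1]
    refine ⟨fun p e => ((M.pred e.1).map χ, act e.1, some (χ e.1)), ?_, ?_⟩
    · refine ⟨?_, ?_, ?_, ?_, ?_, ?_⟩
      · rintro p ⟨e, rfl⟩
        refine ⟨χ e, rfl, ?_⟩
        have hc := hχ e
        dsimp only
        by_cases hs : ∃ f, M.msg e f
        · obtain ⟨f, hf⟩ := hs
          have h2 : (fun r => (M.senderOn r e).map χ) = fun _ => none := by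
            funext r
            rw [M.senderOn_eq_none.2, Option.map_none]
            intro s hs
            have := M.msg_unique _ _ _ _ hs hf (by simp)
            exact absurd (this.1 ▸ hs) fun h => M.msg_loc_ne _ _ h rfl
          rw [h2, M.target_eq_some.2 ⟨f, hf, rfl⟩] at hc
          rw [act_send e f hf]
          exact ⟨(M.msg_loc_ne _ _ hf).symm, rfl, hc⟩
        · by_cases hr : ∃ s, M.msg s e
          · obtain ⟨s, hs'⟩ := hr
            have h2 : (fun r => (M.senderOn r e).map χ) =
                fun r => if r = M.loc s then some (χ s) else none := by
              funext r
              split_ifs with h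
              · rw [M.senderOn_eq_some.2 ⟨hs', h.symm⟩, Option.map_some]
              · rw [M.senderOn_eq_none.2, Option.map_none]
                intro s' h' h''
                rw [(M.msg_unique _ _ _ _ hs' h' (by simp)).1] at h
                exact h h''.symm
            rw [h2, M.target_eq_none.2 (not_exists.1 hs)] at hc
            rw [act_recv s e hs']
            exact ⟨M.msg_loc_ne _ _ hs', hc⟩
          · have h2 : (fun r => (M.senderOn r e).map χ) = fun _ => none := by
              funext r
              rw [M.senderOn_eq_none.2, Option.map_none]
              exact fun s h => absurd ⟨s, h⟩ hr
            rw [h2, M.target_eq_none.2 (not_exists.1 hs)] at hc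
            have : act e = .loc (M.label e) := by simp only [act, dif_neg hs, dif_neg hr]
            rw [this]
            exact hc
      · rintro p ⟨e, rfl⟩
        simp only [act]
        split_ifs <;> rfl
      · rintro p ⟨e, rfl⟩ h
        dsimp only
        rw [M.pred_eq_none.2 (not_exists.1 h)]
        rfl
      · rintro p ⟨e, he⟩ ⟨f, hf⟩ h
        dsimp only
        rw [M.pred_eq_some.2 h]
        rfl
      · rintro p ⟨e, rfl⟩ h
        have hs : ¬ ∃ f, M.msg e f := fun ⟨f, hf⟩ => h ⟨f, .inl hf⟩
        have hr : ¬ ∃ f, M.msg f e := fun ⟨f, hf⟩ => h ⟨f, .inr hf⟩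
        exact ⟨M.label e, by simp only [act, dif_neg hs, dif_neg hr]; rfl⟩
      · rintro p q ⟨e, rfl⟩ ⟨f, rfl⟩ h
        exact ⟨_, _, _, act_send _ _ h, act_recv _ _ h⟩
    · classical
      have key : ∀ p, ∃ s : Option X, (∀ e : {e : M.Event // M.loc e = p},
          (¬ ∃ f : M.Event, M.next e f) → s = some (χ e.1)) ∧
          ((¬ ∃ e : M.Event, M.loc e = p) → s = none) := by
        intro p
        by_cases h : ∃ e : {e : M.Event // M.loc e = p}, ¬ ∃ f, M.next e f
        · obtain ⟨e, he⟩ := h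
          refine ⟨some (χ e.1), fun f hf => ?_, fun h => absurd ⟨e.1, e.2⟩ h⟩
          have hlt : ∀ a b : {e : M.Event // M.loc e = p}, (¬ ∃ f, M.next a f) → ¬ a.1 < b.1 := by
            intro a b ha hab
            rcases Relation.ReflTransGen.cases_head
              (M.reflTransGen_next.2 ⟨a.2.trans b.2.symm, hab.le⟩) with h | ⟨y, h, -⟩
            · exact hab.ne h
            · exact ha ⟨y, h⟩
          rcases M.lt_or_eq_or_gt (e.2.trans f.2.symm) with h | h | h
          · exact absurd h (hlt _ _ he)
          · rw [h]
          · exact absurd h (hlt _ _ hf)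
        · exact ⟨none, fun e he => absurd ⟨e, he⟩ h, fun _ => rfl⟩
      choose s hs using key
      exact ⟨s, Set.mem_univ _, hs⟩

end LocalCheck

/-! ### Walking back along last received messages -/

namespace MSC

variable {P : Type u} {A : Type v} (M : MSC.{u, v, w} P A)

open Classical in
/-- The greatest element of a set of events, if there is one. -/
noncomputable def top (S : Set M.Event) : Option M.Event :=
  if h : ∃ e, IsGreatest S e then some h.choose else none

theorem top_eq_some {S : Set M.Event} {e : M.Event} : M.top S = some e ↔ IsGreatest S e := by
  unfold top
  split_ifs with h
  · rw [Option.some.injEq]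
    exact ⟨fun h' => h' ▸ h.choose_spec, fun h' => h.choose_spec.unique h'⟩
  · simp only [false_iff]
    exact fun h' => h ⟨e, h'⟩

theorem exists_top {S : Set M.Event} {p : P} (hS : ∀ e ∈ S, M.loc e = p) (h : S.Nonempty) :
    ∃ e, M.top S = some e := by
  obtain ⟨m, hm⟩ := S.toFinite.exists_maximal h
  refine ⟨m, M.top_eq_some.2 ⟨hm.prop, fun e he => ?_⟩⟩
  rcases M.le_total_of_loc_eq ((hS e he).trans (hS m hm.prop).symm) with h' | h'
  · exact h'
  · exact hm.le_of_ge he h'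

theorem top_empty : M.top (∅ : Set M.Event) = none := by
  rw [Option.eq_none_iff_forall_ne_some]
  intro e h
  exact (M.top_eq_some.1 h).1

/-- The last message from `r` that has been received on the process of `e` up to `e`. -/
noncomputable def lastSend (r : P) (e : M.Event) : Option M.Event :=
  M.top {s | M.loc s = r ∧ ∃ f, M.msg s f ∧ M.loc f = M.loc e ∧ f ≤ e}

/-- The last message to `t` that has been sent on the process of `e` before `e`. -/
noncomputable def prevSend (t : P) (e : M.Event) : Option M.Event :=
  M.top {s | M.loc s = M.loc e ∧ s < e ∧ ∃ f, M.msg s f ∧ M.loc f = t}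

theorem fifo_le {s f s' f' : M.Event} (h : M.msg s f) (h' : M.msg s' f')
    (hs : M.loc s = M.loc s') (hf : M.loc f = M.loc f') : s ≤ s' ↔ f ≤ f' := by
  have := M.fifo _ _ _ _ h h' hs hf
  rw [reflTransGen_next, reflTransGen_next] at this
  simpa [hs, hf] using this

theorem fifo_lt {s f s' f' : M.Event} (h : M.msg s f) (h' : M.msg s' f')
    (hs : M.loc s = M.loc s') (hf : M.loc f = M.loc f') : s < s' ↔ f < f' := by
  rw [lt_iff_le_not_ge, lt_iff_le_not_ge, M.fifo_le h h' hs hf, M.fifo_le h' h hs.symm hf.symm]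

/-- By FIFO, messages from `r` received earlier on this process were also sent earlier. -/
theorem lastSend_of_recv {r : P} {s e : M.Event} (h : M.senderOn r e = some s) :
    M.lastSend r e = some s := by
  obtain ⟨hmsg, rfl⟩ := M.senderOn_eq_some.1 h
  refine M.top_eq_some.2 ⟨⟨rfl, e, hmsg, rfl, le_rfl⟩, ?_⟩
  rintro s' ⟨hs', f, hf, hfe, hle⟩
  exact (M.fifo_le hf hmsg hs' hfe).2 hle

theorem lastSend_eq_some {r : P} {s e : M.Event} (h : M.lastSend r e = some s) :
    M.loc s = r ∧ s < e := by
  obtain ⟨⟨h1, f, hf, -, hle⟩, -⟩ := M.top_eq_some.1 h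
  exact ⟨h1, (M.msg_lt hf).trans_le hle⟩

theorem pred_bind_lastSend (r : P) (e : M.Event) : (M.pred e).bind (M.lastSend r) =
    M.top {s | M.loc s = r ∧ ∃ f, M.msg s f ∧ M.loc f = M.loc e ∧ f < e} := by
  cases h : M.pred e with
  | none =>
    have : {s | M.loc s = r ∧ ∃ f, M.msg s f ∧ M.loc f = M.loc e ∧ f < e} = ∅ := by
      rw [Set.eq_empty_iff_forall_notMem]
      rintro s ⟨-, f, -, hf, hlt⟩
      exact M.not_lt_of_pred_eq_none h hf hlt
    rw [this, top_empty, Option.bind_none]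
  | some d =>
    rw [Option.bind_some, lastSend, M.loc_pred h]
    congr 1
    ext s
    refine and_congr_right fun _ => exists_congr fun f => and_congr_right fun _ =>
      and_congr_right fun hf => ?_
    exact ⟨fun hle => hle.trans_lt (M.pred_lt h), fun hlt => M.le_pred h hf hlt⟩

theorem lastSend_of_not_recv {r : P} {e : M.Event} (h : M.senderOn r e = none) :
    M.lastSend r e = (M.pred e).bind (M.lastSend r) := by
  rw [pred_bind_lastSend, lastSend]
  congr 1
  ext s
  refine and_congr_right fun hs => exists_congr fun f => and_congr_right fun hm =>
    and_congr_right fun hf => ⟨fun hle => hle.lt_of_ne ?_, fun hlt => hlt.le⟩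
  rintro rfl
  exact M.senderOn_eq_none.1 h s hm hs

/-- By FIFO, the message before `s` on the channel is also the one received last before `e`. This
lets the sender account for what the receiver has already learnt. -/
theorem prevSend_of_recv {r : P} {s e : M.Event} (h : M.senderOn r e = some s) :
    M.prevSend (M.loc e) s = (M.pred e).bind (M.lastSend r) := by
  obtain ⟨hmsg, rfl⟩ := M.senderOn_eq_some.1 h
  rw [pred_bind_lastSend, prevSend]
  congr 1
  ext s'
  refine and_congr_right fun hs => ?_
  constructor
  · rintro ⟨hlt, f, hm, hf⟩
    exact ⟨f, hm, hf, (M.fifo_lt hm hmsg hs hf).1 hlt⟩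
  · rintro ⟨f, hm, hf, hlt⟩
    exact ⟨(M.fifo_lt hm hmsg hs hf).2 hlt, f, hm, hf⟩

open Classical in
theorem prevSend_eq (t : P) (e : M.Event) : M.prevSend t e =
    (M.pred e).bind fun d => if M.target d = some t then some d else M.prevSend t d := by
  cases h : M.pred e with
  | none =>
    have : {s | M.loc s = M.loc e ∧ s < e ∧ ∃ f, M.msg s f ∧ M.loc f = t} = ∅ := by
      rw [Set.eq_empty_iff_forall_notMem]
      rintro s ⟨hs, hlt, -⟩
      exact M.not_lt_of_pred_eq_none h hs hlt
    rw [prevSend, this, top_empty, Option.bind_none]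
  | some d =>
    rw [Option.bind_some]
    split_ifs with ht
    · exact M.top_eq_some.2 ⟨⟨M.loc_pred h, M.pred_lt h, M.target_eq_some.1 ht⟩,
        fun s hs => M.le_pred h hs.1 hs.2.1⟩
    · rw [prevSend, prevSend, M.loc_pred h]
      congr 1
      ext s
      refine and_congr_right fun hs => ?_
      constructor
      · rintro ⟨hlt, hf⟩
        refine ⟨(M.le_pred h hs hlt).lt_of_ne ?_, hf⟩
        rintro rfl
        exact ht (M.target_eq_some.2 hf)
      · rintro ⟨hlt, hf⟩
        exact ⟨hlt.trans (M.pred_lt h), hf⟩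

theorem prevSend_eq_some {t : P} {s e : M.Event} (h : M.prevSend t e = some s) :
    M.loc s = M.loc e ∧ s < e :=
  ⟨(M.top_eq_some.1 h).1.1, (M.top_eq_some.1 h).1.2.1⟩

theorem lastSend_mono {r : P} {d e s : M.Event} (hl : M.loc d = M.loc e) (hle : d ≤ e)
    (h : M.lastSend r d = some s) : ∃ s', M.lastSend r e = some s' ∧ s ≤ s' := by
  obtain ⟨⟨hs, f, hm, hf, hfd⟩, -⟩ := M.top_eq_some.1 h
  have hmem : s ∈ {s | M.loc s = r ∧ ∃ f, M.msg s f ∧ M.loc f = M.loc e ∧ f ≤ e} :=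
    ⟨hs, f, hm, hf.trans hl, hfd.trans hle⟩
  obtain ⟨s', hs'⟩ := M.exists_top (fun e he => he.1) ⟨s, hmem⟩
  exact ⟨s', hs', (M.top_eq_some.1 hs').2 hmem⟩

/-- The event that is reached from `e` by following the last received message backwards,
successively for each process of a list. -/
noncomputable def back : List P → M.Event → Option M.Event
  | [], e => some e
  | r :: v, e => (M.lastSend r e).bind (back v)

theorem back_append (u v : List P) (e : M.Event) :
    M.back (u ++ v) e = (M.back u e).bind (M.back v) := by
  induction u generalizing e with
  | nil => rfl
  | cons r u ih =>
    rw [List.cons_append, back, back, Option.bind_assoc]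
    congr 1
    funext s
    exact ih s

theorem back_mono {v : List P} {d e x : M.Event} (hl : M.loc d = M.loc e) (hle : d ≤ e)
    (h : M.back v d = some x) : ∃ y, M.back v e = some y ∧ x ≤ y := by
  induction v generalizing d e with
  | nil =>
    obtain rfl := Option.some.inj h
    exact ⟨e, rfl, hle⟩
  | cons r v ih =>
    obtain ⟨s, hs, hx⟩ := Option.bind_eq_some_iff.1 h
    obtain ⟨s', hs', hss'⟩ := M.lastSend_mono hl hle hs
    obtain ⟨y, hy, hxy⟩ :=
      ih ((M.lastSend_eq_some hs).1.trans (M.lastSend_eq_some hs').1.symm) hss' hx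
    exact ⟨y, Option.bind_eq_some_iff.2 ⟨s', hs', hy⟩, hxy⟩

theorem loc_back {v : List P} {e x : M.Event} (h : M.back v e = some x) :
    M.loc x = v.getLast?.getD (M.loc e) := by
  induction v generalizing e with
  | nil =>
    obtain rfl := Option.some.inj h
    rfl
  | cons r v ih =>
    obtain ⟨s, hs, hx⟩ := Option.bind_eq_some_iff.1 h
    rw [ih hx, List.getLast?_cons, Option.getD_some, (M.lastSend_eq_some hs).1]

theorem back_le {v : List P} {e x : M.Event} (h : M.back v e = some x) : x ≤ e := by
  induction v generalizing e with
  | nil =>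
    obtain rfl := Option.some.inj h
    rfl
  | cons r v ih =>
    obtain ⟨s, hs, hx⟩ := Option.bind_eq_some_iff.1 h
    exact (ih hx).trans (M.lastSend_eq_some hs).2.le

theorem back_mem_past {v : List P} {e x : M.Event} {p : P} (hv : v.getLast? = some p)
    (h : M.back v e = some x) : x ∈ M.past p e := by
  refine ⟨by rw [M.loc_back h, hv, Option.getD_some], ?_⟩
  cases v with
  | nil => simp at hv
  | cons r v =>
    obtain ⟨s, hs, hx⟩ := Option.bind_eq_some_iff.1 h
    exact (M.back_le hx).trans_lt (M.lastSend_eq_some hs).2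

/-- Induction along a causal path from `f`. A process step only moves the walk forward, by
`back_mono`; a message step prepends the sender's process. -/
theorem exists_back {f e : M.Event} (h : f ≤ e) : ∃ v : List P, (M.loc e :: v).Nodup ∧
    ∃ x, M.back v e = some x ∧ f ≤ x ∧ M.loc x = M.loc f := by
  induction h with
  | refl => exact ⟨[], by simp, f, rfl, le_rfl, rfl⟩
  | @tail d e _ h ih =>
    obtain ⟨v, hv, x, hx, hfx, hlx⟩ := ih
    rcases h with h | h
    · have hl := M.loc_eq_of_next _ _ h
      obtain ⟨y, hy, hxy⟩ := M.back_mono hl (M.next_lt h).le hx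
      refine ⟨v, hl ▸ hv, y, hy, hfx.trans hxy, ?_⟩
      rw [← hlx, M.loc_back hx, M.loc_back hy, hl]
    · have hs : M.back (M.loc d :: v) e = some x := by
        rw [back, M.lastSend_of_recv (M.senderOn_eq_some.2 ⟨h, rfl⟩), Option.bind_some, hx]
      -- If the walk returns to the process of `e` at some `y ≤ e`, the loop is dropped: the
      -- remaining word `t`, started at `e`, reaches an event at least as late.
      by_cases hmem : M.loc e ∈ M.loc d :: v
      · obtain ⟨u, t, ht⟩ := List.append_of_mem hmem
        rw [ht, List.append_cons, back_append] at hs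
        obtain ⟨y, hy, hyx⟩ := Option.bind_eq_some_iff.1 hs
        have hly : M.loc y = M.loc e := by rw [M.loc_back hy]; simp
        obtain ⟨z, hz, hxz⟩ := M.back_mono hly (M.back_le hy) hyx
        refine ⟨t, ?_, z, hz, hfx.trans hxz, ?_⟩
        · rw [ht] at hv
          exact (List.nodup_append.1 hv).2.1
        · rw [← hlx, M.loc_back hyx, M.loc_back hz, hly]
      · exact ⟨M.loc d :: v, List.nodup_cons.2 ⟨hmem, hv⟩, x, hs, hfx, hlx⟩

theorem exists_back_of_mem_past [Finite P] {f e : M.Event} {p : P} (hp : p ≠ M.loc e)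
    (h : f ∈ M.past p e) : ∃ v : List P, v.length ≤ Nat.card P ∧ v.getLast? = some p ∧
      ∃ x, M.back v e = some x ∧ f ≤ x := by
  obtain ⟨v, hv, x, hx, hfx, hlx⟩ := M.exists_back h.2.le
  refine ⟨v, ?_, ?_, x, hx, hfx⟩
  · have := Fintype.ofFinite P
    rw [Nat.card_eq_fintype_card]
    exact (List.nodup_cons.1 hv).2.length_le_card
  · rw [h.1, M.loc_back hx] at hlx
    cases hv' : v.getLast? with
    | none => rw [hv'] at hlx; exact absurd hlx.symm hp
    | some r => rw [hv'] at hlx; exact congrArg some hlx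

theorem latest_eq_none_iff_back [Finite P] {e : M.Event} {p : P} (hp : p ≠ M.loc e) :
    M.latest p e = none ↔ ∀ v : List P, v.length ≤ Nat.card P → v.getLast? = some p →
      M.back v e = none := by
  rw [latest_eq_none_iff]
  constructor
  · intro h v _ hv
    rw [Option.eq_none_iff_forall_ne_some]
    intro x hx
    have := M.back_mem_past hv hx
    rw [h] at this
    exact this
  · intro h
    rw [Set.eq_empty_iff_forall_notMem]
    intro f hf
    obtain ⟨v, hl, hv, x, hx, -⟩ := M.exists_back_of_mem_past hp hf
    rw [h v hl hv] at hx
    cases hx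

theorem exists_back_eq_latest [Finite P] {e m : M.Event} {p : P} (hp : p ≠ M.loc e)
    (h : M.latest p e = some m) : ∃ v : List P, v.length ≤ Nat.card P ∧ v.getLast? = some p ∧
      M.back v e = some m := by
  rw [latest_eq_some_iff] at h
  obtain ⟨v, hl, hv, x, hx, hmx⟩ := M.exists_back_of_mem_past hp h.1
  exact ⟨v, hl, hv, by rw [hx, le_antisymm hmx (h.2 (M.back_mem_past hv hx))]⟩

theorem latest_eq_of_back [Finite P] {e m : M.Event} {p : P} (hp : p ≠ M.loc e)
    {v : List P} (hv : v.getLast? = some p) (hm : M.back v e = some m)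
    (hmax : ∀ u : List P, u.length ≤ Nat.card P → u.getLast? = some p →
      ∀ x, M.back u e = some x → x ≤ m) : M.latest p e = some m := by
  rw [latest_eq_some_iff]
  refine ⟨M.back_mem_past hv hm, fun f hf => ?_⟩
  obtain ⟨u, hul, hu, x, hx, hfx⟩ := M.exists_back_of_mem_past hp hf
  exact hfx.trans (hmax u hul hu x hx)

/-! ### Increments of monotone quantities -/

/-- The increase of `K` from the predecessor of `e` to `e`. -/
noncomputable def jump (K : M.Event → ℕ) (e : M.Event) : ℕ := K e - (M.pred e).elim 0 K

/-- The increase of `K` up to `e` since the last message to `t` before `e`. -/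
noncomputable def growth (K : M.Event → ℕ) (t : P) (e : M.Event) : ℕ :=
  K e - (M.prevSend t e).elim 0 K

/-- A quantity that does not decrease along the processes. -/
def ProcMono (K : M.Event → ℕ) : Prop := ∀ d e, M.loc d = M.loc e → d ≤ e → K d ≤ K e

variable {M}

/-- Monotonicity ensures that the truncated subtraction in `jump` loses nothing. -/
theorem ProcMono.eq_add_jump {K : M.Event → ℕ} (hK : M.ProcMono K) (e : M.Event) :
    K e = (M.pred e).elim 0 K + M.jump K e := by
  unfold jump
  cases h : M.pred e with
  | none => simp
  | some d =>
    have := hK d e (M.loc_pred h) (M.pred_lt h).le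
    simp only [Option.elim_some]
    omega

open Classical in
-- If the predecessor sends to `t`, it becomes the new reference point and the growth restarts from
-- zero; otherwise the reference point is unchanged.
theorem ProcMono.growth_eq {K : M.Event → ℕ} (hK : M.ProcMono K) (t : P) (e : M.Event) :
    M.growth K t e = M.jump K e +
      (M.pred e).elim 0 fun d => if M.target d = some t then 0 else M.growth K t d := by
  unfold growth jump
  rw [prevSend_eq]
  cases h : M.pred e with
  | none => simp
  | some d =>
    have h1 := hK d e (M.loc_pred h) (M.pred_lt h).le
    simp only [Option.elim_some, Option.bind_some]
    split_ifs
    · simp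
    · have h2 : (M.prevSend t d).elim 0 K ≤ K d := by
        cases hs : M.prevSend t d with
        | none => simp
        | some s =>
          exact hK s d (M.prevSend_eq_some hs).1 (M.prevSend_eq_some hs).2.le
      omega

/-- Only a receipt from `r` changes `lastSend r`, and then FIFO moves it from `prevSend` of the
sender to the sender. The jump at the receiver is therefore known at the sender. -/
theorem jump_lastSend (K : M.Event → ℕ) (r : P) (e : M.Event) :
    M.jump (fun x => (M.lastSend r x).elim 0 K) e =
      (M.senderOn r e).elim 0 (M.growth K (M.loc e)) := by
  have h0 : ∀ o : Option M.Event, o.elim 0 (fun x => (M.lastSend r x).elim 0 K) =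
      (o.bind (M.lastSend r)).elim 0 K := by
    rintro (_ | _) <;> rfl
  unfold jump
  rw [h0]
  cases h : M.senderOn r e with
  | none => simp [M.lastSend_of_not_recv h]
  | some s => simp [← M.prevSend_of_recv h, M.lastSend_of_recv h, growth]

variable (M)

/-! ### Counting the elements of a set of events -/

/-- The number of events of `C` on the process of `e` up to `e` (if `b` holds) or before `e`. -/
noncomputable def count (C : Set M.Event) (b : Bool) (e : M.Event) : ℕ :=
  {c ∈ C | M.loc c = M.loc e ∧ (c < e ∨ b = true ∧ c = e)}.ncard

theorem procMono_count (C : Set M.Event) (b : Bool) : M.ProcMono (M.count C b) := by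
  intro d e hl hle
  refine Set.ncard_le_ncard ?_ (Set.toFinite _)
  rintro c ⟨hc, hlc, h⟩
  refine ⟨hc, hlc.trans hl, ?_⟩
  rcases h with h | ⟨hb, rfl⟩
  · exact .inl (h.trans_le hle)
  · rcases hle.lt_or_eq with h | h
    · exact .inl h
    · exact .inr ⟨hb, h⟩

open Classical in
theorem count_true (C : Set M.Event) (e : M.Event) :
    M.count C true e = M.count C false e + if e ∈ C then 1 else 0 := by
  unfold count
  split_ifs with h
  · rw [← Set.ncard_insert_of_notMem (a := e) (by simp) (Set.toFinite _)]
    congr 1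
    ext c
    simp only [true_and, Set.mem_ofPred_eq, false_and, or_false,
      Set.mem_insert_iff]
    constructor
    · rintro ⟨h1, h2, h3 | h3⟩
      · exact .inr ⟨h1, h2, h3⟩
      · exact .inl h3
    · rintro (rfl | ⟨h1, h2, h3⟩)
      · exact ⟨h, rfl, .inr rfl⟩
      · exact ⟨h1, h2, .inl h3⟩
  · rw [add_zero]
    congr 1
    ext c
    simp only [true_and, Set.mem_ofPred_eq, false_and, or_false]
    refine and_congr_right fun hc => and_congr_right fun _ => or_iff_left ?_
    rintro rfl
    exact h hc

theorem count_false (C : Set M.Event) (e : M.Event) :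
    M.count C false e = (M.pred e).elim 0 (M.count C true) := by
  unfold count
  cases h : M.pred e with
  | none =>
    rw [Option.elim_none, Set.ncard_eq_zero (Set.toFinite _), Set.eq_empty_iff_forall_notMem]
    rintro c ⟨-, hl, hlt⟩
    exact M.not_lt_of_pred_eq_none h hl (by simpa using hlt)
  | some d =>
    rw [Option.elim_some, M.loc_pred h]
    congr 1
    ext c
    refine and_congr_right fun _ => and_congr_right fun hl => ?_
    simp only [Bool.false_eq_true, false_and, or_false, true_and]
    rw [← le_iff_lt_or_eq]
    exact ⟨M.le_pred h hl, fun hle => hle.trans_lt (M.pred_lt h)⟩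

open Classical in
theorem jump_count_true (C : Set M.Event) (e : M.Event) :
    M.jump (M.count C true) e = if e ∈ C then 1 else 0 := by
  rw [jump, count_true, count_false, Nat.add_sub_cancel_left]

open Classical in
theorem jump_count_false (C : Set M.Event) (e : M.Event) :
    M.jump (M.count C false) e = (M.pred e).elim 0 fun d => if d ∈ C then 1 else 0 := by
  rw [jump, count_false]
  cases M.pred e with
  | none => rfl
  | some d => simp only [Option.elim_some, count_true, Nat.add_sub_cancel_left]

/-- The number of events of `C` up to (or before) the event that is reached from `e` along `v`. -/
noncomputable def level (C : Set M.Event) (b : Bool) (v : List P) (e : M.Event) : ℕ :=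
  (M.back v e).elim 0 (M.count C b)

theorem level_nil (C : Set M.Event) (b : Bool) : M.level C b [] = M.count C b := rfl

theorem level_cons (C : Set M.Event) (b : Bool) (r : P) (v : List P) :
    M.level C b (r :: v) = fun e => (M.lastSend r e).elim 0 (M.level C b v) := by
  funext e
  unfold level
  rw [back]
  cases M.lastSend r e <;> rfl

theorem procMono_level (C : Set M.Event) (b : Bool) (v : List P) :
    M.ProcMono (M.level C b v) := by
  intro d e hl hle
  unfold level
  cases h : M.back v d with
  | none => exact Nat.zero_le _
  | some x =>
    obtain ⟨y, hy, hxy⟩ := M.back_mono hl hle h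
    rw [hy]
    exact M.procMono_count C b x y (by rw [M.loc_back h, M.loc_back hy, hl]) hxy

/-- If `y < x`, every element of `C` up to `y` lies strictly before `x`, so the counts would be
ordered the other way. Nothing is required of `C`, which makes arbitrary guesses safe. -/
theorem le_of_level_lt {C : Set M.Event} {v v' : List P} {e x y : M.Event}
    (hx : M.back v e = some x) (hy : M.back v' e = some y) (hl : M.loc x = M.loc y)
    (h : M.level C false v e < M.level C true v' e) : x ≤ y := by
  rcases M.lt_or_eq_or_gt hl with h' | h' | h'
  · exact h'.le
  · exact h'.le
  · refine absurd h (not_lt.2 ?_)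
    rw [level, level, hx, hy]
    refine Set.ncard_le_ncard ?_ (Set.toFinite _)
    rintro c ⟨hc, hlc, h⟩
    refine ⟨hc, hlc.trans hl.symm, .inl ?_⟩
    rcases h with h | ⟨-, rfl⟩
    · exact h.trans h'
    · exact h'

end MSC

/-! ### Construction of separating sets -/

/-- Two monotone partial functions from a chain can be compared by counting the elements of a set
`C` below their values, in such a way that the counts differ by at most two and grow slowly. -/
theorem exists_separating_set {α : Type*} {β : Type*} [PartialOrder α] [WellFoundedLT α]
    [Preorder β] (htot : ∀ a b : α, a ≤ b ∨ b ≤ a) (F G : α → Option β)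
    (hF : ∀ a b x, a ≤ b → F a = some x → ∃ y, F b = some y ∧ x ≤ y)
    (hG : ∀ a b x, a ≤ b → G a = some x → ∃ y, G b = some y ∧ x ≤ y) :
    ∃ (C : Set β) (N U V : α → Set β), (∀ c ∈ C, ∃ a, G a = some c) ∧
      (∀ a, U a = {c ∈ C | ∃ x, F a = some x ∧ c < x}) ∧
      (∀ a, V a = {c ∈ C | ∃ y, G a = some y ∧ c ≤ y}) ∧
      (∀ a, U a ⊆ N a) ∧ (∀ a, N a ⊆ V a) ∧
      (∀ a, (N a \ U a).Subsingleton) ∧ (∀ a, (V a \ N a).Subsingleton) ∧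
      (∀ a y, G a = some y → (∀ x, F a = some x → x ≤ y) → (N a \ U a).Nonempty) ∧
      (∀ a b, a < b → (∀ x, x < b → x ≤ a) → (U b \ U a).Subsingleton) ∧
      (∀ a b, a < b → (∀ x, x < b → x ≤ a) → (V b \ V a).Subsingleton) ∧
      (∀ a, (∀ x, ¬ x < a) → U a = ∅) ∧ (∀ a, (∀ x, ¬ x < a) → (V a).Subsingleton) := by
  -- Greedy selection: `a` is selected if `F a ≤ G a` (an undefined `F a` counts as smallest) and `F
  -- a` has passed the value of `G` at every element selected earlier. `C` collects the values of
  -- `G` at selected elements.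
  obtain ⟨R, hR⟩ : ∃ R : α → Prop, ∀ a, R a ↔ (∃ y, G a = some y ∧ ∀ x, F a = some x → x ≤ y) ∧
      ∀ b, b < a → R b → ∃ y x, G b = some y ∧ F a = some x ∧ y < x := by
    refine ⟨WellFounded.fix (wellFounded_lt (α := α)) fun a ih =>
      (∃ y, G a = some y ∧ ∀ x, F a = some x → x ≤ y) ∧
      ∀ b (h : b < a), ih b h → ∃ y x, G b = some y ∧ F a = some x ∧ y < x, fun a => ?_⟩
    rw [WellFounded.fix_eq]
  have hnlt : ∀ {a b : α}, ¬ a ≤ b → b < a := fun {a b} h =>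
    lt_of_le_not_ge ((htot a b).resolve_left h) h
  have hlt : ∀ a b y, a < b → R a → R b → G a = some y → ∃ x, F b = some x ∧ y < x := by
    intro a b y hab ha hb hy
    obtain ⟨y', x, hy', hx, h⟩ := ((hR b).1 hb).2 a hab ha
    rw [hy] at hy'
    obtain rfl := Option.some.inj hy'
    exact ⟨x, hx, h⟩
  have hFG : ∀ a x y, R a → F a = some x → G a = some y → x ≤ y := by
    intro a x y ha hx hy
    obtain ⟨⟨y', hy', h⟩, -⟩ := (hR a).1 ha
    rw [hy] at hy'
    obtain rfl := Option.some.inj hy'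
    exact h x hx
  have hGlt : ∀ a b y z, a < b → R a → R b → G a = some y → G b = some z → y < z := by
    intro a b y z hab ha hb hy hz
    obtain ⟨x, hx, hyx⟩ := hlt a b y hab ha hb hy
    exact hyx.trans_le (hFG b x z hb hx hz)
  have hsub : ∀ (T : Set β), (∀ c ∈ T, ∃ a, R a ∧ G a = some c) →
      (∀ a b y z, a < b → R a → R b → G a = some y → G b = some z → y ∈ T → z ∈ T → False) →
      T.Subsingleton := by
    intro T hT h y hy z hz
    obtain ⟨a, ha, hay⟩ := hT y hy
    obtain ⟨b, hb, hbz⟩ := hT z hz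
    by_cases hab : a = b
    · subst hab
      exact Option.some.inj (hay.symm.trans hbz)
    · rcases htot a b with h' | h'
      · exact (h a b y z (lt_of_le_of_ne h' hab) ha hb hay hbz hy hz).elim
      · exact (h b a z y (lt_of_le_of_ne h' (Ne.symm hab)) hb ha hbz hay hz hy).elim
  set C : Set β := {c | ∃ a, R a ∧ G a = some c} with hC
  set U : α → Set β := fun a => {c ∈ C | ∃ x, F a = some x ∧ c < x} with hU
  set V : α → Set β := fun a => {c ∈ C | ∃ y, G a = some y ∧ c ≤ y} with hV
  set N : α → Set β := fun a => {c | ∃ b, b ≤ a ∧ R b ∧ G b = some c} with hN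
  -- an element that lies below the value of `F` was created strictly before
  have hUlt : ∀ a b c, c ∈ U a → R b → G b = some c → b < a := by
    rintro a b c ⟨-, x, hx, hcx⟩ hb hc
    refine hnlt fun hab => ?_
    obtain ⟨x', hx', hxx'⟩ := hF a b x hab hx
    exact lt_irrefl _ (hcx.trans_le (hxx'.trans (hFG b x' c hb hx' hc)))
  have hNV : ∀ a, N a ⊆ V a := by
    rintro a c ⟨b, hba, hb, hc⟩
    obtain ⟨y, hy, hcy⟩ := hG b a c hba hc
    exact ⟨⟨b, hb, hc⟩, y, hy, hcy⟩
  -- For selected `b < d ≤ a`, `G b < F d ≤ F a`; hence only the last selected value can lie outside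
  -- `U a`.
  have hNU : ∀ a, (N a \ U a).Subsingleton := by
    intro a
    refine hsub _ (fun c ⟨⟨b, _, hb, hc⟩, _⟩ => ⟨b, hb, hc⟩) ?_
    rintro b d y z hbd hb hd hy hz ⟨-, hyU⟩ ⟨⟨d', hd'a, hd', hz'⟩, -⟩
    have hda : d ≤ a := by
      by_contra hda
      exact lt_irrefl _ (hGlt d' d z z (hd'a.trans_lt (hnlt hda)) hd' hd hz' hz)
    obtain ⟨x, hx, hyx⟩ := hlt b d y hbd hb hd hy
    obtain ⟨x', hx', hxx'⟩ := hF d a x hda hx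
    exact hyU ⟨⟨b, hb, hy⟩, x', hx', hyx.trans_le hxx'⟩
  -- If two values in `T` came from selected `b < d` with `a ≤ b`, then `G b < G d ≤ G a ≤ G b`,
  -- which is impossible.
  have hVlate : ∀ a (T : Set β), T ⊆ V a → (∀ b y, b < a → R b → G b = some y → y ∉ T) →
      T.Subsingleton := by
    intro a T hTV hT
    refine hsub _ (fun c hc => (hTV hc).1) ?_
    intro b d y z hbd hb hd hy hz hyT hzT
    have hab : a ≤ b := by
      by_contra hab
      exact hT b y (hnlt hab) hb hy hyT
    obtain ⟨-, t, ht, hzt⟩ := hTV hzT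
    obtain ⟨y', hy', hty'⟩ := hG a b t hab ht
    rw [hy] at hy'
    obtain rfl := Option.some.inj hy'
    exact lt_irrefl _ ((hGlt b d y z hbd hb hd hy hz).trans_le (hzt.trans hty'))
  refine ⟨C, N, U, V, fun c ⟨a, _, hc⟩ => ⟨a, hc⟩, fun _ => rfl, fun _ => rfl, ?_, hNV, hNU,
    ?_, ?_, ?_, ?_, ?_, ?_⟩
  · rintro a c hcU
    obtain ⟨b, hb, hc⟩ := hcU.1
    exact ⟨b, (hUlt a b c hcU hb hc).le, hb, hc⟩
  · intro a
    exact hVlate a _ Set.sdiff_subset fun b y hba hb hy h => h.2 ⟨b, hba.le, hb, hy⟩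
  · intro a y hy hxy
    -- If `a` is selected, `G a` is the witness. Otherwise the selection failed because of an
    -- earlier selected `b` whose value `F a` has not passed, and `G b` is the witness.
    by_cases ha : R a
    · refine ⟨y, ⟨a, le_rfl, ha, hy⟩, fun h => ?_⟩
      exact lt_irrefl _ (hUlt a a y h ha hy)
    · rw [hR] at ha
      push Not at ha
      obtain ⟨b, hba, hb, h⟩ := ha ⟨y, hy, hxy⟩
      obtain ⟨⟨z, hz, -⟩, -⟩ := (hR b).1 hb
      refine ⟨z, ⟨b, hba.le, hb, hz⟩, ?_⟩
      rintro ⟨-, x, hx, hzx⟩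
      exact h z x hz hx hzx
  · intro a b hab hmax
    refine (hNU a).anti ?_
    rintro c ⟨hcb, hca⟩
    obtain ⟨d, hd, hc⟩ := hcb.1
    exact ⟨⟨d, hmax d (hUlt b d c hcb hd hc), hd, hc⟩, hca⟩
  · intro a b hab hmax
    refine hVlate b _ Set.sdiff_subset fun d y hd hRd hy h => ?_
    exact h.2 (hNV a ⟨d, hmax d hd, hRd, hy⟩)
  · intro a ha
    rw [Set.eq_empty_iff_forall_notMem]
    intro c hc
    obtain ⟨b, hb, hbc⟩ := hc.1
    exact ha b (hUlt a b c hc hb hbc)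
  · intro a ha
    exact hVlate a _ subset_rfl fun b _ hb => absurd hb (ha b)

namespace MSC

variable {P : Type u} {A : Type v} (M : MSC.{u, v, w} P A)

theorem level_empty (b : Bool) (v : List P) (e : M.Event) : M.level ∅ b v e = 0 := by
  unfold level
  cases M.back v e <;> simp [count]

/-- The set `C` compares the events that are reached along `v` and `v'` from process `q`. -/
structure Separates (q : P) (v v' : List P) (C : Set M.Event) : Prop where
  jump_left : ∀ e, M.loc e = q → M.jump (M.level C false v) e ≤ 1
  jump_right : ∀ e, M.loc e = q → M.jump (M.level C true v') e ≤ 1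
  le : ∀ e, M.loc e = q → M.level C false v e ≤ M.level C true v' e
  le_add : ∀ e, M.loc e = q → M.level C true v' e ≤ M.level C false v e + 2
  lt : ∀ p e, M.loc e = q → v.getLast? = some p → v'.getLast? = some p →
    ∀ y, M.back v' e = some y → (∀ x, M.back v e = some x → x ≤ y) →
      M.level C false v e < M.level C true v' e

theorem exists_separates (q : P) (v v' : List P) : ∃ C, M.Separates q v v' C := by
  -- Without a common last letter no comparison is required, and the empty set will do.
  by_cases hp : ∃ p, v.getLast? = some p ∧ v'.getLast? = some p
  swap
  · refine ⟨∅, ?_, ?_, ?_, ?_, fun p _ _ h h' => absurd ⟨p, h, h'⟩ hp⟩ <;>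
      simp [level_empty, jump]
  obtain ⟨p, hv, hv'⟩ := hp
  have := Finite.to_wellFoundedLT (α := {e : M.Event // M.loc e = q})
  obtain ⟨C, N, U, V, hC, hU, hV, hUN, hNV, hNU, hVN, hne, hUU, hVV, hU0, hV0⟩ :=
    exists_separating_set (α := {e : M.Event // M.loc e = q})
      (fun a b => M.le_total_of_loc_eq (a.2.trans b.2.symm))
      (fun a => M.back v a) (fun a => M.back v' a)
      (fun a b x hab h => M.back_mono (a.2.trans b.2.symm) hab h)
      (fun a b x hab h => M.back_mono (a.2.trans b.2.symm) hab h)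
  have hCp : ∀ c ∈ C, M.loc c = p := by
    intro c hc
    obtain ⟨a, ha⟩ := hC c hc
    rw [M.loc_back ha, hv', Option.getD_some]
  have hlU : ∀ a : {e : M.Event // M.loc e = q}, M.level C false v a = (U a).ncard := by
    intro a
    rw [hU, level]
    cases h : M.back v a with
    | none => simp
    | some x =>
      rw [Option.elim_some, count]
      congr 1
      ext c
      simp only [Set.mem_ofPred_eq, Bool.false_eq_true, false_and, or_false, Option.some.injEq,
        exists_eq_left']
      refine and_congr_right fun hc => and_iff_right ?_
      rw [hCp c hc, M.loc_back h, hv, Option.getD_some]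
  have hlV : ∀ a : {e : M.Event // M.loc e = q}, M.level C true v' a = (V a).ncard := by
    intro a
    rw [hV, level]
    cases h : M.back v' a with
    | none => simp
    | some x =>
      rw [Option.elim_some, count]
      congr 1
      ext c
      simp only [Set.mem_ofPred_eq, true_and, Option.some.injEq, exists_eq_left',
        ← le_iff_lt_or_eq]
      refine and_congr_right fun hc => and_iff_right ?_
      rw [hCp c hc, M.loc_back h, hv', Option.getD_some]
  have hfin : ∀ S : Set M.Event, S.Finite := fun S => S.toFinite
  have hdiff : ∀ S T : Set M.Event, (S \ T).Subsingleton → S.ncard ≤ T.ncard + 1 := by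
    intro S T h
    have h1 := Set.ncard_le_ncard_sdiff_add_ncard S T (hfin T)
    have h2 := Set.ncard_le_one_iff_subsingleton.2 h
    omega
  have hjump : ∀ (K : M.Event → ℕ) (S : {e : M.Event // M.loc e = q} → Set M.Event),
      (∀ a : {e : M.Event // M.loc e = q}, K a = (S a).ncard) →
      (∀ a b, a < b → (∀ x, x < b → x ≤ a) → (S b \ S a).Subsingleton) →
      (∀ a, (∀ x, ¬ x < a) → (S a).Subsingleton) → ∀ e, M.loc e = q → M.jump K e ≤ 1 := by
    intro K S hK h1 h2 e he
    unfold jump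
    cases h : M.pred e with
    | none =>
      rw [hK ⟨e, he⟩, Option.elim_none, Nat.sub_zero]
      exact Set.ncard_le_one_iff_subsingleton.2
        (h2 _ fun x hx => M.not_lt_of_pred_eq_none h (x.2.trans he.symm) hx)
    | some d =>
      rw [hK ⟨e, he⟩, Option.elim_some, hK ⟨d, (M.loc_pred h).trans he⟩]
      have := hdiff _ _ (h1 ⟨d, (M.loc_pred h).trans he⟩ ⟨e, he⟩ (M.pred_lt h)
        fun x hx => M.le_pred h (x.2.trans he.symm) hx)
      omega
  refine ⟨C, ⟨hjump _ U hlU hUU fun a ha => by simp [hU0 a ha], hjump _ V hlV hVV hV0,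
    ?_, ?_, ?_⟩⟩
  · intro e he
    rw [hlU ⟨e, he⟩, hlV ⟨e, he⟩]
    exact Set.ncard_le_ncard ((hUN _).trans (hNV _)) (hfin _)
  · intro e he
    rw [hlU ⟨e, he⟩, hlV ⟨e, he⟩]
    -- The bound 2 is one for each of the inclusions `U ⊆ N ⊆ V`.
    have h1 := hdiff _ _ (hVN ⟨e, he⟩)
    have h2 := hdiff _ _ (hNU ⟨e, he⟩)
    omega
  · intro _ e he _ _ y hy hxy
    rw [hlU ⟨e, he⟩, hlV ⟨e, he⟩]
    obtain ⟨c, hcN, hcU⟩ := hne ⟨e, he⟩ y hy hxy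
    exact Set.ncard_lt_ncard ⟨(hUN _).trans (hNV _), fun h => hcU (h (hNV _ hcN))⟩ (hfin _)

end MSC

/-! ### The annotation of the gossip machine and its local condition -/

/-- The words over `P` of length at most `|P|`. -/
abbrev ShortWord (P : Type u) := {v : List P // v.length ≤ Nat.card P}

/-- The empty word. -/
def ShortWord.nil (P : Type u) : ShortWord P := ⟨[], Nat.zero_le _⟩

/-- The word without its first letter. -/
def ShortWord.tail {P : Type u} {r : P} {v : List P} (h : (r :: v).length ≤ Nat.card P) :
    ShortWord P := ⟨v, (Nat.le_succ _).trans h⟩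

/-- A process and two words, whose targets are to be compared on that process. -/
abbrev Comparison (P : Type u) := P × ShortWord P × ShortWord P

/-- The information that the gossip machine keeps about an event. -/
structure GossipInfo (P : Type u) (L : Type v) : Type (max u v) where
  /-- the target of a message that is sent -/
  target : Option P
  /-- the separating sets to which the event belongs -/
  cut : Comparison P → Prop
  /-- the label of the event that is reached along a word -/
  label : ShortWord P → Option L
  /-- the growth of the level along a word since the last message to a process, cut off at 2 -/
  growth : Comparison P → Bool → P → ShortWord P → Fin 3
  /-- the difference of the levels along the two words of a comparison -/
  diff : Comparison P → Fin 3

namespace GossipInfo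

variable {P : Type u} {L : Type v}

open Classical in
/-- The jump of the level along a word, cut off at 2. -/
noncomputable def jump (p : P) (prev : Option (GossipInfo P L))
    (recv : P → Option (GossipInfo P L)) (x : GossipInfo P L) (i : Comparison P) (b : Bool) :
    ShortWord P → ℕ
  | ⟨[], _⟩ =>
    if b then (if x.cut i then 1 else 0) else prev.elim 0 fun y => if y.cut i then 1 else 0
  | ⟨r :: _, h⟩ => (recv r).elim 0 fun y => y.growth i b p (ShortWord.tail h)

open Classical in
/-- The local condition that is checked by the gossip machine. -/
structure Check (p : P) (a : L × (P → Option L)) (prev : Option (GossipInfo P L))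
    (recv : P → Option (GossipInfo P L)) (target : Option P) (x : GossipInfo P L) : Prop where
  target_eq : x.target = target
  label_nil : x.label (ShortWord.nil P) = some a.1
  label_cons : ∀ (r : P) (v : List P) (h : (r :: v).length ≤ Nat.card P), x.label ⟨r :: v, h⟩ =
    (recv r).elim (prev.bind fun y => y.label ⟨r :: v, h⟩) fun y => y.label (ShortWord.tail h)
  -- Cutting off at 2 is compatible with addition, so the recursion for the growth survives it.
  growth_eq : ∀ i b t v, (x.growth i b t v : ℕ) = min 2 (x.jump p prev recv i b v +
    prev.elim 0 fun y => if y.target = some t then 0 else (y.growth i b t v : ℕ))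
  jump_left : ∀ i, i.1 = p → x.jump p prev recv i false i.2.1 ≤ 1
  jump_right : ∀ i, i.1 = p → x.jump p prev recv i true i.2.2 ≤ 1
  -- As `diff` takes values in `Fin 3`, this also rejects guesses for which the difference would
  -- leave `{0, 1, 2}`.
  diff_eq : ∀ i, i.1 = p → (x.diff i : ℕ) + x.jump p prev recv i false i.2.1 =
    (prev.elim 0 fun y => (y.diff i : ℕ)) + x.jump p prev recv i true i.2.2
  output_self : a.2 p = prev.bind fun y => y.label (ShortWord.nil P)
  output : ∀ q, q ≠ p →
    (a.2 q = none ∧ ∀ v : ShortWord P, v.1.getLast? = some q → x.label v = none) ∨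
    ∃ v' : ShortWord P, v'.1.getLast? = some q ∧ x.label v' = a.2 q ∧ a.2 q ≠ none ∧
      ∀ v : ShortWord P, v.1.getLast? = some q → x.label v ≠ none → 1 ≤ (x.diff (p, v, v') : ℕ)

end GossipInfo

/-! ### Correctness of the local condition -/

section Language

variable {P : Type u} {L : Type v} (M : ExtMSC.{u, v, w} P L)

/-- The label in `L` of the event that is reached along a word. -/
noncomputable def MSC.backLabel (v : List P) (e : M.Event) : Option L :=
  (M.back v e).map fun x => (M.label x).1

theorem MSC.backLabel_cons (r : P) (v : List P) (e : M.Event) : M.backLabel (r :: v) e =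
    (M.senderOn r e).elim ((M.pred e).bind (M.backLabel (r :: v))) (M.backLabel v) := by
  cases h : M.senderOn r e with
  | none =>
    rw [Option.elim_none, backLabel, back, M.lastSend_of_not_recv h]
    cases M.pred e <;> rfl
  | some s =>
    rw [Option.elim_some, backLabel, back, M.lastSend_of_recv h]
    rfl

theorem MSC.backLabel_eq_none {v : List P} {e : M.Event} :
    M.backLabel v e = none ↔ M.back v e = none := by
  rw [backLabel, Option.map_eq_none_iff]

/-- The information about an event that belongs to the sets `C`. -/
noncomputable def MSC.gossipInfo (C : Comparison P → Set M.Event) (e : M.Event) :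
    GossipInfo P L where
  target := M.target e
  cut i := e ∈ C i
  label v := M.backLabel v.1 e
  growth i b t v := ⟨min 2 (M.growth (M.level (C i) b v.1) t e), by omega⟩
  diff i := ⟨min 2 (M.level (C i) true i.2.2.1 e - M.level (C i) false i.2.1.1 e), by omega⟩

open Classical in
/-- If the cuts and the growth are correct up to `e`, then so are the jumps at `e`. -/
theorem MSC.jump_eq_min {χ : M.Event → GossipInfo P L} {e : M.Event} {i : Comparison P} {b : Bool}
    {C : Set M.Event} (hC : ∀ e, e ∈ C ↔ (χ e).cut i) (v : ShortWord P)
    (h : ∀ s v', s < e → ((χ s).growth i b (M.loc e) v' : ℕ) =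
      min 2 (M.growth (M.level C b v'.1) (M.loc e) s)) :
    (χ e).jump (M.loc e) ((M.pred e).map χ) (fun r => (M.senderOn r e).map χ) i b v =
      min 2 (M.jump (M.level C b v.1) e) := by
  obtain ⟨_ | ⟨r, v⟩, hv⟩ := v
  · cases b
    · rw [level_nil, jump_count_false, GossipInfo.jump]
      cases M.pred e with
      | none => rfl
      | some d =>
        simp only [Option.map_some, Option.elim_some, hC, Bool.false_eq_true, if_false]
        split_ifs <;> rfl
    · rw [level_nil, jump_count_true, GossipInfo.jump]
      simp only [hC, if_true]
      split_ifs <;> rfl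
  · rw [level_cons, jump_lastSend, GossipInfo.jump]
    cases hs : M.senderOn r e with
    | none => rfl
    | some s => exact h s _ (M.msg_lt (M.senderOn_eq_some.1 hs).1)

/-- Soundness: the labels and the growths are forced by induction along the causal order, the
growths relative to whatever sets `C` were guessed, and `le_of_level_lt` then certifies the chosen
maximum. -/
theorem MSC.gossip_of_isLocallyValid [Finite P] {χ : M.Event → GossipInfo P L}
    (h : M.IsLocallyValid GossipInfo.Check χ) : M ∈ gossipLanguage P L := by
  classical
  have hlabel : ∀ e (v : ShortWord P), (χ e).label v = M.backLabel v.1 e := by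
    intro e
    induction e using M.event_induction with
    | h e ih =>
      rintro ⟨_ | ⟨r, v⟩, hv⟩
      · exact (h e).label_nil
      · rw [(h e).label_cons, M.backLabel_cons]
        cases hs : M.senderOn r e with
        | some s => exact ih s (M.msg_lt (M.senderOn_eq_some.1 hs).1) _
        | none =>
          cases hd : M.pred e with
          | none => rfl
          | some d => exact ih d (M.pred_lt hd) _
  set C : Comparison P → Set M.Event := fun i => {e | (χ e).cut i} with hC
  have hCi : ∀ i e, e ∈ C i ↔ (χ e).cut i := fun _ _ => Iff.rfl
  have hgrowth : ∀ i b e t (v : ShortWord P), ((χ e).growth i b t v : ℕ) =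
      min 2 (M.growth (M.level (C i) b v.1) t e) := by
    intro i b e
    induction e using M.event_induction with
    | h e ih =>
      intro t v
      rw [(h e).growth_eq, M.jump_eq_min (hCi i) v fun s v' hs => ih s hs _ _,
        (M.procMono_level _ _ _).growth_eq]
      cases hd : M.pred e with
      | none => simp
      | some d =>
        simp only [Option.map_some, Option.elim_some, (h d).target_eq, ih d (M.pred_lt hd)]
        split_ifs <;> omega
  have hjump : ∀ i b e (v : ShortWord P), (χ e).jump (M.loc e) ((M.pred e).map χ)
      (fun r => (M.senderOn r e).map χ) i b v = min 2 (M.jump (M.level (C i) b v.1) e) :=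
    fun i b e v => M.jump_eq_min (hCi i) v fun s v' _ => hgrowth i b s _ v'
  have hdiff : ∀ i e, M.loc e = i.1 → ((χ e).diff i : ℕ) + M.level (C i) false i.2.1.1 e =
      M.level (C i) true i.2.2.1 e := by
    intro i e
    induction e using M.event_induction with
    | h e ih =>
      intro he
      -- A cut-off jump of at most 1 equals the true jump, so the differences add up exactly.
      have h1 := (h e).jump_left i he.symm
      have h2 := (h e).jump_right i he.symm
      have h3 := (h e).diff_eq i he.symm
      rw [hjump] at h1 h2
      rw [hjump, hjump] at h3
      rw [(M.procMono_level _ _ _).eq_add_jump e,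
        (M.procMono_level (C i) true i.2.2.1).eq_add_jump e]
      cases hd : M.pred e with
      | none =>
        rw [hd] at h3
        simp only [Option.map_none, Option.elim_none] at h3 ⊢
        omega
      | some d =>
        rw [hd] at h3
        have := ih d (M.pred_lt hd) ((M.loc_pred hd).trans he)
        simp only [Option.map_some, Option.elim_some] at h3 ⊢
        omega
  intro e
  funext q
  by_cases hq : q = M.loc e
  · subst hq
    rw [(h e).output_self, ← pred]
    cases hd : M.pred e with
    | none => rfl
    | some d => exact hlabel d _
  · rcases (h e).output q hq with ⟨h1, h2⟩ | ⟨v', hv', h1, h2, h3⟩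
    · rw [h1, (M.latest_eq_none_iff_back hq).2, Option.map_none]
      intro v hl hv
      rw [← M.backLabel_eq_none]
      exact (hlabel e ⟨v, hl⟩).symm.trans (h2 ⟨v, hl⟩ hv)
    · rw [← h1, hlabel] at h2 ⊢
      rw [Ne, M.backLabel_eq_none] at h2
      obtain ⟨m, hm⟩ := Option.ne_none_iff_exists'.1 h2
      rw [M.latest_eq_of_back hq hv' hm, backLabel, hm]
      intro u hul hu x hx
      refine M.le_of_level_lt (C := C (M.loc e, ⟨u, hul⟩, v')) hx hm ?_ ?_
      · rw [M.loc_back hx, M.loc_back hm, hu, hv']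
      · have h4 := h3 ⟨u, hul⟩ hu (by
          rw [hlabel, Ne, M.backLabel_eq_none, hx]
          exact Option.some_ne_none x)
        have h5 := hdiff (M.loc e, ⟨u, hul⟩, v') e rfl
        dsimp only at h5
        omega

/-- Completeness: the true values relative to separating sets pass every check; the bounds in
`Separates` ensure that neither the checked jumps nor the differences are affected by the cut-off.
-/
theorem MSC.exists_isLocallyValid [Finite P] (h : M ∈ gossipLanguage P L) :
    ∃ χ, M.IsLocallyValid (GossipInfo.Check (P := P) (L := L)) χ := by
  classical
  choose C hC using fun i : Comparison P => M.exists_separates i.1 i.2.1.1 i.2.2.1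
  have hjump : ∀ i b e (v : ShortWord P), (M.gossipInfo C e).jump (M.loc e)
      ((M.pred e).map (M.gossipInfo C)) (fun r => (M.senderOn r e).map (M.gossipInfo C)) i b v =
      min 2 (M.jump (M.level (C i) b v.1) e) :=
    fun i b e v => M.jump_eq_min (fun _ => Iff.rfl) v fun _ _ _ => rfl
  refine ⟨M.gossipInfo C, fun e => ⟨rfl, rfl, ?_, ?_, ?_, ?_, ?_, ?_, ?_⟩⟩
  · intro r v hv
    refine (M.backLabel_cons r v e).trans ?_
    cases M.senderOn r e with
    | some s => rfl
    | none => cases M.pred e <;> rfl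
  · intro i b t v
    rw [hjump]
    change min 2 (M.growth (M.level (C i) b v.1) t e) = _
    rw [(M.procMono_level _ _ _).growth_eq]
    cases hd : M.pred e with
    | none => simp
    | some d =>
      simp only [Option.map_some, Option.elim_some, gossipInfo]
      split_ifs <;> omega
  · intro i hi
    rw [hjump]
    exact (min_le_right _ _).trans ((hC i).jump_left e hi.symm)
  · intro i hi
    rw [hjump]
    exact (min_le_right _ _).trans ((hC i).jump_right e hi.symm)
  · intro i hi
    rw [hjump, hjump]
    have h1 := (hC i).jump_left e hi.symm
    have h2 := (hC i).jump_right e hi.symm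
    have h3 := (hC i).le e hi.symm
    have h4 := (hC i).le_add e hi.symm
    have h5 := (M.procMono_level (C i) false i.2.1.1).eq_add_jump e
    have h6 := (M.procMono_level (C i) true i.2.2.1).eq_add_jump e
    simp only [gossipInfo]
    cases hd : M.pred e with
    | none =>
      rw [hd] at h5 h6
      simp only [Option.map_none, Option.elim_none] at h5 h6 ⊢
      omega
    | some d =>
      rw [hd] at h5 h6
      have h7 := (hC i).le d ((M.loc_pred hd).trans hi.symm)
      have h8 := (hC i).le_add d ((M.loc_pred hd).trans hi.symm)
      simp only [Option.map_some, Option.elim_some, gossipInfo] at h5 h6 ⊢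
      omega
  · rw [h e]
    change (M.pred e).map _ = _
    cases M.pred e <;> rfl
  · intro q hq
    rw [h e]
    dsimp only
    cases hm : M.latest q e with
    | none =>
      refine .inl ⟨rfl, fun v hv => ?_⟩
      exact M.backLabel_eq_none.2 ((M.latest_eq_none_iff_back hq).1 hm v.1 v.2 hv)
    | some m =>
      obtain ⟨v', hl', hv', hm'⟩ := M.exists_back_eq_latest hq hm
      refine .inr ⟨⟨v', hl'⟩, hv', ?_, Option.some_ne_none _, fun v hv _ => ?_⟩
      · change M.backLabel v' e = _
        rw [backLabel, hm']
      · have h1 := (hC (M.loc e, v, ⟨v', hl'⟩)).lt q e rfl hv hv' m hm' fun x hx =>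
          (M.latest_eq_some_iff.1 hm).2 (M.back_mem_past hv hx)
        dsimp only at h1
        simp only [gossipInfo]
        omega

end Language

/-! ### Bounding the number of states -/

section Cardinality

variable {P : Type u} {L : Type v}

/-- The information as a tuple. -/
def GossipInfo.toProd (x : GossipInfo P L) :
    Option P × (Comparison P → Prop) × (ShortWord P → Option L) ×
      (Comparison P × Bool × P × ShortWord P → Fin 3) × (Comparison P → Fin 3) :=
  (x.target, x.cut, x.label, fun j => x.growth j.1 j.2.1 j.2.2.1 j.2.2.2, x.diff)

theorem GossipInfo.toProd_injective :
    Function.Injective (GossipInfo.toProd (P := P) (L := L)) := by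
  rintro ⟨t, c, l, g, d⟩ ⟨t', c', l', g', d'⟩ h
  simp only [toProd, Prod.mk.injEq] at h
  obtain ⟨rfl, rfl, rfl, hg, rfl⟩ := h
  have : g = g' := by
    funext i b t v
    exact congrFun hg (i, b, t, v)
  rw [this]

/-- The letters of a word, by position. -/
def ShortWord.letters (v : ShortWord P) : Fin (Nat.card P) → Option P := fun k => v.1[k.1]?

theorem ShortWord.letters_injective : Function.Injective (ShortWord.letters (P := P)) := by
  intro v v' h
  refine Subtype.ext (List.ext_getElem? fun k => ?_)
  by_cases hk : k < Nat.card P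
  · exact congrFun h ⟨k, hk⟩
  · rw [List.getElem?_eq_none (by have := v.2; omega),
      List.getElem?_eq_none (by have := v'.2; omega)]

instance [Finite P] : Finite (ShortWord P) := Finite.of_injective _ ShortWord.letters_injective

instance [Finite P] [Finite L] : Finite (GossipInfo P L) :=
  Finite.of_injective _ GossipInfo.toProd_injective

theorem ShortWord.card_le [Finite P] :
    Nat.card (ShortWord P) ≤ (Nat.card P + 1) ^ Nat.card P := by
  refine (Nat.card_le_card_of_injective _ ShortWord.letters_injective).trans ?_
  rw [Nat.card_fun, Finite.card_option, Nat.card_fin]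

theorem GossipInfo.card_le [Finite P] [Finite L] : Nat.card (GossipInfo P L) ≤
    (Nat.card P + 1) * (2 ^ Nat.card (Comparison P) *
      ((Nat.card L + 1) ^ Nat.card (ShortWord P) *
        (3 ^ (Nat.card (Comparison P) * (2 * (Nat.card P * Nat.card (ShortWord P)))) *
          3 ^ Nat.card (Comparison P)))) := by
  refine (Nat.card_le_card_of_injective _ GossipInfo.toProd_injective).trans ?_
  simp only [Nat.card_prod, Nat.card_fun, Finite.card_option, Nat.card_fin]
  simp [Nat.card_eq_fintype_card]

theorem card_mul_gossipInfo_le [Finite P] [Finite L] :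
    Nat.card P * (Nat.card (GossipInfo P L) + 1) ≤
      max (Nat.card L) 2 ^ (max (Nat.card P) 2 ^ (12 * Nat.card P)) := by
  have hI : Nat.card (Comparison P) =
      Nat.card P * (Nat.card (ShortWord P) * Nat.card (ShortWord P)) := by
    simp only [Nat.card_prod]
  have hX := GossipInfo.card_le (P := P) (L := L)
  have hW := ShortWord.card_le (P := P)
  rw [hI] at hX
  generalize Nat.card (ShortWord P) = W at hX hW
  generalize Nat.card (GossipInfo P L) = X at hX ⊢
  generalize Nat.card P = n at hX hW ⊢
  generalize Nat.card L = l at hX ⊢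
  rcases Nat.eq_zero_or_pos n with rfl | hn
  · simp
  set m := max l 2 with hm
  set N := max n 2 with hN
  have hm2 : 2 ≤ m := le_max_right _ _
  have hN2 : 2 ≤ N := le_max_right _ _
  have hnN : n ≤ N ^ n := (Nat.lt_pow_self hN2).le
  have hWN : W ≤ N ^ (2 * n) := by
    refine hW.trans ?_
    rw [pow_mul]
    refine Nat.pow_le_pow_left ?_ n
    have : n ≤ N := le_max_left _ _
    nlinarith
  have h3 : 3 ≤ m ^ 2 := by nlinarith
  have hl : l + 1 ≤ m ^ 2 := by
    have : l ≤ m := le_max_left _ _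
    nlinarith
  have hnm : n + 1 ≤ m ^ n := (Nat.lt_two_pow_self).trans_le (Nat.pow_le_pow_left hm2 n)
  set I := n * (W * W) with hI
  have hXm : X ≤ m ^ (n + (I + (2 * W + (2 * (I * (2 * (n * W))) + 2 * I)))) := by
    refine hX.trans ?_
    simp only [pow_add]
    refine Nat.mul_le_mul hnm (Nat.mul_le_mul (Nat.pow_le_pow_left hm2 _)
      (Nat.mul_le_mul ?_ (Nat.mul_le_mul ?_ ?_))) <;> rw [pow_mul m 2] <;>
      apply Nat.pow_le_pow_left <;> assumption
  have hIN : I ≤ N ^ (5 * n) := by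
    calc n * (W * W) ≤ N ^ n * (N ^ (2 * n) * N ^ (2 * n)) := by gcongr
      _ = N ^ (5 * n) := by rw [← pow_add, ← pow_add]; congr 1; ring
  have hIWN : I * (n * W) ≤ N ^ (8 * n) := by
    calc I * (n * W) ≤ N ^ (5 * n) * (N ^ n * N ^ (2 * n)) := by gcongr
      _ = N ^ (8 * n) := by rw [← pow_add, ← pow_add]; congr 1; ring
  have hmono : ∀ k, k ≤ 8 → N ^ (k * n) ≤ N ^ (8 * n) := fun k hk =>
    Nat.pow_le_pow_right (by omega) (Nat.mul_le_mul_right n hk)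
  have h1 := hmono 1 (by omega)
  have h2 := hmono 2 (by omega)
  have h5 := hmono 5 (by omega)
  rw [one_mul] at h1
  -- The terms of the final exponent are multiples of quantities at most `N ^ (8 * n)`, with
  -- coefficients summing to 12. Rounded up to 16, this factor is absorbed by `N ^ (4 * n)`, whence
  -- `12 * n`.
  have h16 : 16 ≤ N ^ (4 * n) :=
    calc 16 = 2 ^ 4 := rfl
      _ ≤ N ^ 4 := Nat.pow_le_pow_left hN2 4
      _ ≤ N ^ (4 * n) := Nat.pow_le_pow_right (by omega) (by omega)
  calc n * (X + 1) ≤ m ^ n * m ^ (n + (I + (2 * W + (2 * (I * (2 * (n * W))) + 2 * I))) + 1) := by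
        refine Nat.mul_le_mul (by omega) ?_
        rw [pow_succ]
        have : 1 ≤ m ^ (n + (I + (2 * W + (2 * (I * (2 * (n * W))) + 2 * I)))) :=
          Nat.one_le_pow _ _ (by omega)
        nlinarith
    _ ≤ m ^ (16 * N ^ (8 * n)) := by
        rw [← pow_add]
        refine Nat.pow_le_pow_right (by omega) ?_
        have : I * (2 * (n * W)) = 2 * (I * (n * W)) := by ring
        have h0 : 1 ≤ N ^ (8 * n) := Nat.one_le_pow _ _ (by omega)
        omega
    _ ≤ m ^ (N ^ (12 * n)) := by
        refine Nat.pow_le_pow_right (by omega) ?_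
        calc 16 * N ^ (8 * n) ≤ N ^ (4 * n) * N ^ (8 * n) := Nat.mul_le_mul_right _ h16
          _ = N ^ (12 * n) := by rw [← pow_add]; congr 1; ring

end Cardinality

theorem mainTheorem1 :
    ∃ c : ℝ, 0 < c ∧
      ∀ (P : Type u) (L : Type v) [Fintype P] [Fintype L],
        ∃ G : CFM.{u, max u v} P (L × (P → Option L)),
          CFM.language.{u, max u v, w} G = gossipLanguage.{u, v, w} P L ∧
          (G.numStates : ℝ) ≤
            (max (Fintype.card L) 2 : ℝ) ^
              ((2 : ℝ) ^ (c * Fintype.card P * Real.log (max (Fintype.card P) 2))) := by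
  have hlog : 0 < Real.log 2 := Real.log_pos one_lt_two
  -- `Real.log` is the natural logarithm; dividing by `Real.log 2` turns the power of 2 into `max
  -- |P| 2 ^ (12 * |P|)`.
  refine ⟨12 / Real.log 2, by positivity, fun P L _ _ => ?_⟩
  refine ⟨CFM.ofCheck (X := GossipInfo P L) GossipInfo.Check, ?_, ?_⟩
  · ext M
    rw [CFM.mem_language_ofCheck]
    exact ⟨fun ⟨_, h⟩ => M.gossip_of_isLocallyValid h, M.exists_isLocallyValid⟩
  · rw [CFM.numStates_ofCheck]
    have h := card_mul_gossipInfo_le (P := P) (L := L)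
    simp only [Nat.card_eq_fintype_card (α := P), Nat.card_eq_fintype_card (α := L)] at h
    have hexp : (2 : ℝ) ^ (12 / Real.log 2 * Fintype.card P *
        Real.log (max (Fintype.card P) 2)) =
        ((max (Fintype.card P) 2 ^ (12 * Fintype.card P) : ℕ) : ℝ) := by
      have hpos : (0 : ℝ) < max (Fintype.card P : ℝ) 2 := lt_max_of_lt_right two_pos
      rw [Real.rpow_def_of_pos two_pos, Nat.cast_pow, Nat.cast_max, Nat.cast_ofNat,
        ← Real.rpow_natCast, Real.rpow_def_of_pos hpos]
      congr 1
      push_cast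
      field_simp
    rw [hexp, Real.rpow_natCast]
    exact_mod_cast h
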